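/- **Model.** Let $\mathbb X$ (states) and $\mathbb A$ (actions) be Borel subsets of complete separable metric spaces. For each $x\in\mathbb X$ let $A(x)\subseteq\mathbb A$ be a nonempty Borel set of available actions, such that $\mathrm{Gr}(A)=\{(x,a):a\in A(x)\}$ is Borel and contains the graph of a Borel function $\mathbb X\to\mathbb A$. Let $c:\mathrm{Gr}(A)\to[0,\infty)$ be a Borel function and let $q(\cdot\mid x,a)$, $(x,a)\in\mathrm{Gr}(A)$, be a Borel kernel of finite measures on $\mathbb X$ with $\sup_{\mathrm{Gr}(A)}q(\mathbb X\mid x,a)<\infty$. Put $\alpha(x,a)=q(\mathbb X\mid x,a)$ and $p(\cdot\mid x,a)=q(\cdot\mid x,a)/\alpha(x,a)$ (an arbitrary probability measure if $\alpha(x,a)=0$). Let $\Pi$ be the set of history-dependent randomized policies, and for $\pi\in\Pi$ and $x\in\mathbb X$ let $\mathbb E^\pi_x$ be the expectation for the process $(x_n,a_n)_{n\ge0}$ with initial state $x$, actions drawn by $\pi$ and transitions $p$. The total cost and the value function are $$v^\pi(x)=\mathbb E_x^\pi\sum_{n=0}^\infty\Big(\prod_{k=0}^{n-1}\alpha(x_k,a_k)\Big)c(x_n,a_n)\in[0,\infty],\qquad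 v(x)=\inf_{\pi\in\Pi}v^\pi(x)\in[0,\infty].$$ A policy $\pi$ is *total-cost optimal* if $v^{\pi}(x)=v(x)$ for all $x$; it is also called *$\beta$-optimal* if $\alpha\equiv\beta$ on $\mathrm{Gr}(A)$. Stationary policies are identified with Borel maps $\varphi:\mathbb X\to\mathbb A$ with $\varphi(x)\in A(x)$ for all $x$; write $c_\varphi(x)=c(x,\varphi(x))$ and $Q_\varphi u(x)=\int_{\mathbb X} u(y)\,q(dy\mid x,\varphi(x))$. **Assumption T.** $V:\mathbb X\to[1,\infty)$ is continuous and $K\ge0$ is a constant such that $\sum_{n=0}^\infty Q_\varphi^nV(x)\le KV(x)$ for all stationary $\varphi$ and all $x\in\mathbb X$. **Assumption WC.** (i) Each $A(x)$ is compact and $x\mapsto A(x)$ is continuous, i.e. $\{x:A(x)\subseteq U\}$ and $\{x:A(x)\cap U\ne\emptyset\}$ are open for every open $U\subseteq\mathbb A$; (ii) $(x,a)\mapsto\int f(y)\,q(dy\mid x,a)$ is continuous on $\mathrm{Gr}(A)$ for every bounded continuous $f:\mathbb X\to\mathbb R$; (iii) $c$ is lower semicontinuous on $\mathrm{Gr}(A)$.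 **HV transformation.** Let $\mu:\mathbb X\to[1,\infty)$ be continuous with $V\le\mu\le KV$ and $\mu(x)\ge V(x)+\int\mu(y)\,q(dy\mid x,a)$ on $\mathrm{Gr}(A)$, and let $\tilde\beta\in[(K-1)/K,1)$ with $\tilde\beta>0$. The HV-transformed MDP has state space $\mathbb X\cup\{\tilde x\}$ and action space $\mathbb A\cup\{\tilde a\}$, where $\tilde x\notin\mathbb X$ and $\tilde a\notin\mathbb A$ are isolated points; the available actions are $A(x)$ at $x\in\mathbb X$ and $\{\tilde a\}$ at $\tilde x$; the costs are $\tilde c(x,a)=c(x,a)/\mu(x)$ and $\tilde c(\tilde x,\tilde a)=0$; the transition probabilities are $\tilde p(B\mid x,a)=\frac{1}{\tilde\beta\mu(x)}\int_B\mu(y)\,q(dy\mid x,a)$ for Borel $B\subseteq\mathbb X$, $\tilde p(\{\tilde x\}\mid x,a)=1-\tilde p(\mathbb X\mid x,a)$ and $\tilde p(\{\tilde x\}\mid\tilde x,\tilde a)=1$; and the discount factor is $\tilde\beta$, i.e. the transition kernel is $\tilde\beta\tilde p$. A stationary policy $\varphi$ is identified with its extension by $\tilde x\mapsto\tilde a$.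 **Corollary.** Suppose that Assumptions T and WC hold and that $(x,a)\mapsto\int_{\mathbb X} V(y)\,q(dy\mid x,a)$ is continuous on $\mathrm{Gr}(A)$. Then: (i) $v$ is Borel measurable and for every $x\in\mathbb X$ $$v(x)=\min_{a\in A(x)}\Big[c(x,a)+\int_{\mathbb X}v(y)\,q(dy\mid x,a)\Big],$$ the minimum being attained; (ii) there is a stationary policy that is total-cost optimal; (iii) a stationary policy $\varphi$ is total-cost optimal if and only if $v(x)=c_\varphi(x)+Q_\varphi v(x)$ for all $x\in\mathbb X$. Moreover, a function $\mu$ as above exists, and for every such $\mu$ and every $\tilde\beta$ as above, the latter condition holds if and only if $\varphi$ is $\tilde\beta$-optimal for the HV-transformed MDP. -/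

import Mathlib

open MeasureTheory ProbabilityTheory Set
open scoped ENNReal NNReal

noncomputable section

/-- A Markov decision process with state space `X` and action space `A`. The one-step cost `c` and
the transition kernel `q` (finite measures with bounded total mass, not necessarily probability
measures) are functions of pairs `(x, a)`; only their values at feasible pairs, `a ∈ act x`,
matter, and functions given on feasible pairs alone may be extended by zero. -/
structure MDP (X A : Type*) [MeasurableSpace X] [MeasurableSpace A] where
  /-- the set of available actions -/
  act : X → Set A
  act_nonempty : ∀ x, (act x).Nonempty
  measurableSet_graph : MeasurableSet {z : X × A | z.2 ∈ act z.1}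
  exists_selector : ∃ f : X → A, Measurable f ∧ ∀ x, f x ∈ act x
  /-- the one-step cost -/
  c : X × A → ℝ≥0
  measurable_c : Measurable c
  /-- the transition kernel -/
  q : Kernel (X × A) X
  finite_q : IsFiniteKernel q

namespace MDP

section Basic

variable {X A : Type*} [MeasurableSpace X] [MeasurableSpace A] (M : MDP X A)

/-- The set of feasible state-action pairs. -/
def graph : Set (X × A) := {z | z.2 ∈ M.act z.1}

/-- Histories `x₀ a₀ … xₙ₋₁ aₙ₋₁ xₙ`: the past state-action pairs and the current state. -/
abbrev Hist (X A : Type*) (n : ℕ) : Type _ := (Fin n → X × A) × X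

/-- History-dependent randomized policies. -/
structure Policy where
  rule : ∀ n : ℕ, Kernel (Hist X A n) A
  markov : ∀ n, IsMarkovKernel (rule n)
  feasible : ∀ n h, rule n h (M.act h.2) = 1

/-- Stationary policies. -/
structure Stationary where
  toFun : X → A
  measurable : Measurable toFun
  feasible : ∀ x, toFun x ∈ M.act x

/-- The policy that selects the action `φ x` whenever the current state is `x`. -/
def Stationary.toPolicy {M : MDP X A} (φ : M.Stationary) : M.Policy where
  rule n := Kernel.deterministic (fun h : Hist X A n => φ.toFun h.2)
    (φ.measurable.comp measurable_snd)
  markov _ := inferInstance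
  feasible n h := by
    have hs : MeasurableSet (M.act h.2) :=
      measurable_prodMk_left (x := h.2) M.measurableSet_graph
    rw [Kernel.deterministic_apply' _ _ hs, indicator_of_mem (φ.feasible h.2)]

/-- The total mass `α (x, a) = q(X | x, a)`. -/
def mass (z : X × A) : ℝ≥0∞ := M.q z univ

lemma measurable_mass : Measurable M.mass := M.q.measurable_coe MeasurableSet.univ

open Classical in
/-- The normalized transition probabilities `p = q / α`. Where `α = 0` an arbitrary choice is made;
it does not affect the expected costs below. -/
def p : Kernel (X × A) X where
  toFun z := if M.mass z = 0 then Measure.dirac z.1 else (M.mass z)⁻¹ • M.q z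
  measurable' := by
    refine Measurable.ite (M.measurable_mass (measurableSet_singleton 0)) ?_ ?_
    · exact Measure.measurable_dirac.comp measurable_fst
    · refine Measure.measurable_of_measurable_coe _ fun s hs => ?_
      simp only [Measure.smul_apply, smul_eq_mul]
      exact M.measurable_mass.inv.mul (M.q.measurable_coe hs)

instance : IsMarkovKernel M.p := by
  refine ⟨fun z => ⟨?_⟩⟩
  have := M.finite_q
  change (if M.mass z = 0 then Measure.dirac z.1 else (M.mass z)⁻¹ • M.q z) univ = 1
  split_ifs with h
  · simp
  · rw [Measure.smul_apply, smul_eq_mul]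
    exact ENNReal.inv_mul_cancel h (measure_ne_top _ _)

variable {M}

/-- Given the state-action pairs up to epoch `n`, the conditional law of the next pair: the state
is drawn from `p`, then the action from the policy. -/
def Policy.step (π : M.Policy) (n : ℕ) : Kernel (Π _ : Finset.Iic n, X × A) (X × A) :=
  (M.p.comap (fun h : (Π _ : Finset.Iic n, X × A) => h ⟨n, Finset.mem_Iic.2 le_rfl⟩)
      (measurable_pi_apply _)).compProd
    ((π.rule (n + 1)).comap
      (fun g : (Π _ : Finset.Iic n, X × A) × X =>
        ((fun i : Fin (n + 1) => g.1 ⟨i, Finset.mem_Iic.2 (Nat.lt_succ_iff.1 i.2)⟩, g.2) :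
          Hist X A (n + 1)))
      (by fun_prop))

instance (π : M.Policy) (n : ℕ) : IsMarkovKernel (π.step n) := by
  have := π.markov (n + 1)
  unfold Policy.step
  infer_instance

/-- The law of the trajectory `(xₙ, aₙ)ₙ` under the policy `π` from the initial state `x`. -/
def Policy.traj (π : M.Policy) (x : X) : Measure (ℕ → X × A) :=
  Kernel.trajMeasure (X := fun _ => X × A)
    ((π.rule 0 (Fin.elim0, x)).map (fun a => (x, a))) π.step

/-- The expected total cost `E ∑ₙ (∏_{k<n} α (x_k, a_k)) c (x_n, a_n)`, an element of `[0, ∞]`. -/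
def Policy.cost (π : M.Policy) (x : X) : ℝ≥0∞ :=
  ∫⁻ ω, ∑' n : ℕ, (∏ k ∈ Finset.range n, M.mass (ω k)) * (M.c (ω n) : ℝ≥0∞) ∂(π.traj x)

variable (M)

/-- The total-cost value function. -/
def value (x : X) : ℝ≥0∞ := ⨅ π : M.Policy, π.cost x

variable {M}

/-- Total-cost optimality of a policy. -/
def Policy.IsOptimal (π : M.Policy) : Prop := ∀ x, π.cost x = M.value x

/-- `β`-optimality: total-cost optimality, when `α` is constantly `β` at feasible pairs. -/
def Policy.IsBetaOptimal (π : M.Policy) (β : ℝ≥0) : Prop :=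
  (∀ z ∈ M.graph, M.mass z = β) ∧ π.IsOptimal

/-- The cost `c_φ` under a stationary policy. -/
def Stationary.c (φ : M.Stationary) (x : X) : ℝ≥0∞ := M.c (x, φ.toFun x)

/-- The operator `Q_φ` of a stationary policy, on `[0, ∞]`-valued functions. -/
def Stationary.Q (φ : M.Stationary) (u : X → ℝ≥0∞) (x : X) : ℝ≥0∞ :=
  ∫⁻ y, u y ∂(M.q (x, φ.toFun x))

end Basic

section Topological

variable {X A : Type*} [MeasurableSpace X] [MeasurableSpace A] [TopologicalSpace X]
  [TopologicalSpace A] (M : MDP X A)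

/-- `V : X → [1, ∞)` is continuous and `∑ₙ Q_φⁿ V ≤ K V` for every stationary policy `φ`. -/
structure AssumptionT (V : X → ℝ≥0) (K : ℝ≥0) : Prop where
  continuous : Continuous V
  one_le : ∀ x, 1 ≤ V x
  bound : ∀ (φ : M.Stationary) (x : X),
    ∑' n : ℕ, (φ.Q^[n] (fun y => (V y : ℝ≥0∞))) x ≤ K * V x

/-- Compact-valued continuous action sets, weakly continuous transition kernel, lower
semicontinuous cost. -/
structure AssumptionWC : Prop where
  isCompact_act : ∀ x, IsCompact (M.act x)
  isOpen_subset : ∀ U : Set A, IsOpen U → IsOpen {x | M.act x ⊆ U}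
  isOpen_inter : ∀ U : Set A, IsOpen U → IsOpen {x | (M.act x ∩ U).Nonempty}
  weak_continuous : ∀ f : BoundedContinuousFunction X ℝ,
    ContinuousOn (fun z => ∫ y, f y ∂(M.q z)) M.graph
  lsc_c : LowerSemicontinuousOn M.c M.graph

/-- The functions `μ` that may be used in the HV transformation. -/
structure IsHVWeight (V : X → ℝ≥0) (K : ℝ≥0) (μ : X → ℝ≥0) : Prop where
  continuous : Continuous μ
  one_le : ∀ x, 1 ≤ μ x
  le_weight : ∀ x, V x ≤ μ x
  weight_le : ∀ x, μ x ≤ K * V x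
  excessive : ∀ x, ∀ a ∈ M.act x, (V x : ℝ≥0∞) + ∫⁻ y, μ y ∂(M.q (x, a)) ≤ μ x

end Topological

section HV

variable {X A : Type*} [MeasurableSpace X] [MeasurableSpace A] (M : MDP X A)

/-- The available actions in the HV-transformed model. The new state and the new action are both
`Sum.inr ()`. -/
def hvAct : X ⊕ Unit → Set (A ⊕ Unit)
  | Sum.inl x => Sum.inl '' M.act x
  | Sum.inr _ => {Sum.inr ()}

open Classical in
/-- The cost `μ⁻¹ c` of the HV-transformed model, zero at the new state. -/
def hvCost (μ : X → ℝ≥0) : (X ⊕ Unit) × (A ⊕ Unit) → ℝ≥0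
  | (Sum.inl x, Sum.inl a) => if a ∈ M.act x then (μ x)⁻¹ * M.c (x, a) else 0
  | _ => 0

/-- The measure `B ↦ (β μ(x))⁻¹ ∫_B μ(y) q(dy | x, a)` on `X`. -/
def hvSub (μ : X → ℝ≥0) (β : ℝ≥0) (z : X × A) : Measure X :=
  ((β * μ z.1 : ℝ≥0) : ℝ≥0∞)⁻¹ • (M.q z).withDensity (fun y => (μ y : ℝ≥0∞))

open Classical in
/-- The transition probabilities of the HV-transformed model: `hvSub` on `X`, the remaining mass at
the new state, which is absorbing. Infeasible pairs are sent to the new state. -/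
def hvProb (μ : X → ℝ≥0) (β : ℝ≥0) : (X ⊕ Unit) × (A ⊕ Unit) → Measure (X ⊕ Unit)
  | (Sum.inl x, Sum.inl a) =>
      if a ∈ M.act x then
        (M.hvSub μ β (x, a)).map Sum.inl
          + (1 - M.hvSub μ β (x, a) univ) • Measure.dirac (Sum.inr ())
      else Measure.dirac (Sum.inr ())
  | _ => Measure.dirac (Sum.inr ())

lemma measurable_of_sumProdSum {X A Y : Type*} [MeasurableSpace X] [MeasurableSpace A]
    [MeasurableSpace Y] {f : (X ⊕ Unit) × (A ⊕ Unit) → Y}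
    (h₁ : Measurable fun z : X × A => f (Sum.inl z.1, Sum.inl z.2))
    (h₂ : Measurable fun z : X × Unit => f (Sum.inl z.1, Sum.inr z.2))
    (h₃ : Measurable fun z : Unit × A => f (Sum.inr z.1, Sum.inl z.2))
    (h₄ : Measurable fun z : Unit × Unit => f (Sum.inr z.1, Sum.inr z.2)) :
    Measurable f := by
  rw [← (MeasurableEquiv.sumProdSum X Unit A Unit).symm.measurable_comp_iff]
  exact (h₁.sumElim h₂).sumElim (h₃.sumElim h₄)

lemma measurable_hvCost {μ : X → ℝ≥0} (hμ : Measurable μ) : Measurable (M.hvCost μ) := by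
  classical
  refine measurable_of_sumProdSum ?_ measurable_const measurable_const measurable_const
  exact Measurable.ite M.measurableSet_graph
    ((hμ.comp measurable_fst).inv.mul M.measurable_c) measurable_const

lemma measurable_hvSub {μ : X → ℝ≥0} (hμ : Measurable μ) (β : ℝ≥0) :
    Measurable (M.hvSub μ β) := by
  have := M.finite_q
  refine Measure.measurable_of_measurable_coe _ fun s hs => ?_
  have h1 : Measurable fun z : X × A => ∫⁻ y in s, (μ y : ℝ≥0∞) ∂(M.q z) :=
    Measurable.setLIntegral_kernel hμ.coe_nnreal_ennreal hs
  have h2 : Measurable fun z : X × A => ((β * μ z.1 : ℝ≥0) : ℝ≥0∞)⁻¹ :=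
    ((measurable_const.mul (hμ.comp measurable_fst)).coe_nnreal_ennreal).inv
  have h3 : (fun z : X × A => M.hvSub μ β z s) = fun z =>
      ((β * μ z.1 : ℝ≥0) : ℝ≥0∞)⁻¹ * ∫⁻ y in s, (μ y : ℝ≥0∞) ∂(M.q z) := by
    funext z
    simp only [hvSub, Measure.smul_apply, smul_eq_mul, withDensity_apply _ hs]
  rw [h3]
  exact h2.mul h1

lemma measurable_hvProb {μ : X → ℝ≥0} (hμ : Measurable μ) (β : ℝ≥0) :
    Measurable (M.hvProb μ β) := by
  classical
  have hsub := M.measurable_hvSub hμ β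
  refine measurable_of_sumProdSum ?_ measurable_const measurable_const measurable_const
  refine Measurable.ite M.measurableSet_graph ?_ measurable_const
  refine Measure.measurable_of_measurable_coe _ fun s hs => ?_
  simp only [Measure.add_apply, Measure.smul_apply, smul_eq_mul]
  refine Measurable.add ?_ (Measurable.mul ?_ measurable_const)
  · exact (Measure.measurable_coe hs).comp
      ((Measure.measurable_map _ measurable_inl).comp hsub)
  · exact measurable_const.sub ((Measure.measurable_coe MeasurableSet.univ).comp hsub)

variable [TopologicalSpace X] [BorelSpace X] {M}

lemma IsHVWeight.hvSub_le_one {V : X → ℝ≥0} {K : ℝ≥0} {μ : X → ℝ≥0} (hμ : M.IsHVWeight V K μ)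
    {β : ℝ≥0} (hβ : 0 < β) (hKβ : ((K : ℝ) - 1) / K ≤ β) {z : X × A} (hz : z ∈ M.graph) :
    M.hvSub μ β z univ ≤ 1 := by
  obtain ⟨x, a⟩ := z
  have hexc := hμ.excessive x a hz
  have hfin : ∫⁻ y, (μ y : ℝ≥0∞) ∂(M.q (x, a)) ≠ ⊤ := fun h => by simp [h] at hexc
  obtain ⟨i, hi⟩ : ∃ i : ℝ≥0, (i : ℝ≥0∞) = ∫⁻ y, (μ y : ℝ≥0∞) ∂(M.q (x, a)) :=
    ⟨_, ENNReal.coe_toNNReal hfin⟩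
  rw [← hi] at hexc
  have hexc' : (V x : ℝ) + i ≤ μ x := by exact_mod_cast hexc
  have h1 : (1 : ℝ) ≤ μ x := by exact_mod_cast hμ.one_le x
  have hle : (μ x : ℝ) ≤ K * V x := by exact_mod_cast hμ.weight_le x
  have hV : (0 : ℝ) ≤ V x := (V x).2
  have hK : (0 : ℝ) < K := by
    rcases (K.2 : (0 : ℝ) ≤ K).lt_or_eq with h | h
    · exact h
    · have h0 : (K : ℝ) = 0 := h.symm
      rw [h0] at hle
      linarith
  have hVμ : (μ x : ℝ) / K ≤ V x := by rw [div_le_iff₀ hK]; linarith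
  have hkey : (i : ℝ) ≤ β * μ x := by
    have := mul_le_mul_of_nonneg_right hKβ (by linarith : (0 : ℝ) ≤ μ x)
    have h2 : ((K : ℝ) - 1) / K * μ x = μ x - μ x / K := by field_simp
    linarith
  have hkey' : i ≤ β * μ x := by exact_mod_cast hkey
  have hpos : β * μ x ≠ 0 := (mul_pos hβ (lt_of_lt_of_le one_pos (hμ.one_le x))).ne'
  simp only [hvSub, Measure.smul_apply, smul_eq_mul, withDensity_apply _ MeasurableSet.univ,
    Measure.restrict_univ]
  rw [← hi, ← ENNReal.coe_inv hpos, ← ENNReal.coe_mul]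
  have : (β * μ x)⁻¹ * i ≤ 1 := by
    rw [mul_comm, ← div_eq_mul_inv]
    exact div_le_one_of_le₀ hkey' zero_le
  exact_mod_cast this

lemma IsHVWeight.hvProb_univ {V : X → ℝ≥0} {K : ℝ≥0} {μ : X → ℝ≥0} (hμ : M.IsHVWeight V K μ)
    {β : ℝ≥0} (hβ : 0 < β) (hKβ : ((K : ℝ) - 1) / K ≤ β) (z : (X ⊕ Unit) × (A ⊕ Unit)) :
    M.hvProb μ β z univ = 1 := by
  classical
  rcases z with ⟨x | u, a | w⟩
  · simp only [hvProb]
    split_ifs with h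
    · rw [Measure.add_apply, Measure.map_apply measurable_inl MeasurableSet.univ]
      simp only [preimage_univ, Measure.smul_apply, measure_univ, smul_eq_mul, mul_one]
      exact add_tsub_cancel_of_le (hμ.hvSub_le_one hβ hKβ h)
    · simp
  all_goals simp [hvProb]

/-- The MDP defined by the HV transformation with parameters `μ` and `β`: its transition
probabilities are `hvProb`, and the discount factor `β` is a factor of its transition kernel. -/
def hv {V : X → ℝ≥0} {K : ℝ≥0} {μ : X → ℝ≥0} (hμ : M.IsHVWeight V K μ)
    {β : ℝ≥0} (hβ : 0 < β) (hKβ : ((K : ℝ) - 1) / K ≤ β) : MDP (X ⊕ Unit) (A ⊕ Unit) where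
  act := M.hvAct
  act_nonempty := by
    rintro (x | u)
    · exact (M.act_nonempty x).image _
    · exact singleton_nonempty _
  measurableSet_graph := by
    rw [← measurable_mem]
    refine measurable_of_sumProdSum ?_ ?_ ?_ ?_
    · have : (fun z : X × A => ((Sum.inl z.1, Sum.inl z.2) : (X ⊕ Unit) × (A ⊕ Unit)) ∈
          {z : (X ⊕ Unit) × (A ⊕ Unit) | z.2 ∈ M.hvAct z.1}) =
          fun z => z ∈ {z : X × A | z.2 ∈ M.act z.1} := by
        funext z; simp [hvAct]
      rw [this]
      exact measurable_mem.2 M.measurableSet_graph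
    · simp [hvAct]
    · simp [hvAct]
    · simp [hvAct]
  exists_selector := by
    obtain ⟨f, hf, hfa⟩ := M.exists_selector
    refine ⟨Sum.map f id, ?_, ?_⟩
    · exact (measurable_inl.comp hf).sumElim (measurable_inr.comp measurable_id)
    · rintro (x | u)
      · exact mem_image_of_mem _ (hfa x)
      · exact rfl
  c := M.hvCost μ
  measurable_c := M.measurable_hvCost hμ.continuous.measurable
  q :=
    { toFun := fun z => (β : ℝ≥0∞) • M.hvProb μ β z
      measurable' := by
        refine Measure.measurable_of_measurable_coe _ fun s hs => ?_
        simp only [Measure.smul_apply, smul_eq_mul]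
        exact measurable_const.mul ((Measure.measurable_coe hs).comp
          (M.measurable_hvProb hμ.continuous.measurable β)) }
  finite_q := by
    refine ⟨⟨β, ENNReal.coe_lt_top, fun z => ?_⟩⟩
    change ((β : ℝ≥0∞) • M.hvProb μ β z) univ ≤ β
    rw [Measure.smul_apply, hμ.hvProb_univ hβ hKβ, smul_eq_mul, mul_one]

/-- The stationary policy of the HV-transformed model that corresponds to `φ`. -/
def Stationary.hv (φ : M.Stationary) {V : X → ℝ≥0} {K : ℝ≥0} {μ : X → ℝ≥0}
    (hμ : M.IsHVWeight V K μ) {β : ℝ≥0} (hβ : 0 < β) (hKβ : ((K : ℝ) - 1) / K ≤ β) :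
    (MDP.hv hμ hβ hKβ).Stationary where
  toFun := Sum.map φ.toFun id
  measurable := (measurable_inl.comp φ.measurable).sumElim (measurable_inr.comp measurable_id)
  feasible := by
    rintro (x | u)
    · exact mem_image_of_mem _ (φ.feasible x)
    · exact rfl

end HV

end MDP

end

/-!
The optimality statements rest on value iteration from zero, `vₙ = Tⁿ 0`, for the optimality operator
`T u (x) = inf_a (c (x, a) + ∫ u dq)`. Under weak continuity every `vₙ` is lower semicontinuous
(`lowerSemicontinuousOn_lintegral` for the integrals, Berge's theorem `lowerSemicontinuous_biInf` for
the infima), and compactness of the action sets turns the limit `v∞` into a fixed point of `T`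
(`AssumptionWC.bellman_iSup_valueIter`) whose minimizers form a stationary policy `φ`
(`exists_measurable_argmin`). No policy costs less than any `vₙ` (`Policy.le_cost`), while the cost of
a stationary policy is the least solution of `u ≥ c_φ + Q_φ u` (`Stationary.cost_le`), so the cost of
`φ` is at most `v∞`. Hence `v = v∞`, and `φ` is optimal. Since the cost of a stationary policy solves
`u = c_φ + Q_φ u`, the same minimality shows that a stationary policy is optimal if and only if
`v = c_φ + Q_φ v`. The transience assumption plays no role here.

It enters in the construction of the weight `μ` (`AssumptionT.exists_isHVWeight`), the maximal total
reward for the one-step reward `V`, that is, the solution of `U = V + sup_a ∫ U dq`. The difficulty is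
that the assumption bounds stationary policies only, whereas the solution involves all of them, and
that the solution has to be continuous. For the kernel `δ q` with `δ = 1 / (2 K)` both are clear: the
maximization operator contracts the weight `V`, so its fixed point `U` is continuous, is attained by a
stationary policy, and is therefore at most `K V`. This last bound in turn gives
`δ sup_a ∫ U dq = U - V ≤ (1 - 1 / K) U`, so that with the weight `U` the operator remains a
contraction when `δ` is multiplied by `1 + 1 / K`, and finitely many such steps lead to `δ = 1`.

The HV transformation carries the one-step operators of the original model to those of the new one
through `w ↦ μ⁻¹ w` (`bellman_hvLift`, `Stationary.hv_Q`). Hence it divides stationary costs and value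
iterates by `μ`, and with them the value function (`AssumptionWC.hv_value`), so that the optimal
stationary policies of the two models correspond.
-/

noncomputable section

open Filter Topology

namespace MDP

/-! ### Semicontinuity of infima over a compact-valued multifunction -/

section Berge

variable {X A : Type*} [TopologicalSpace X] [TopologicalSpace A]

/-- The tube lemma for an upper hemicontinuous multifunction: a property that holds near every
point of the fibre over `x` holds on all nearby fibres. -/
lemma eventually_forall_mem {Φ : X → Set A} {x : X} (hc : IsCompact (Φ x))
    (hu : ∀ U : Set A, IsOpen U → IsOpen {x | Φ x ⊆ U}) {P : X × A → Prop}
    (h : ∀ a ∈ Φ x, ∀ᶠ z in 𝓝[{z : X × A | z.2 ∈ Φ z.1}] (x, a), P z) :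
    ∀ᶠ y in 𝓝 x, ∀ a ∈ Φ y, P (y, a) := by
  have key : ∃ U : Set A, IsOpen U ∧ Φ x ⊆ U ∧ ∀ᶠ y in 𝓝 x, ∀ b ∈ U, b ∈ Φ y → P (y, b) := by
    refine hc.induction_on (p := fun s => ∃ U : Set A, IsOpen U ∧ s ⊆ U ∧
      ∀ᶠ y in 𝓝 x, ∀ b ∈ U, b ∈ Φ y → P (y, b)) ?_ ?_ ?_ ?_
    · exact ⟨∅, isOpen_empty, subset_rfl, by simp⟩
    · rintro s t hst ⟨U, hU, htU, hP⟩
      exact ⟨U, hU, hst.trans htU, hP⟩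
    · rintro s t ⟨U, hU, hsU, hP⟩ ⟨W, hW, htW, hQ⟩
      refine ⟨U ∪ W, hU.union hW, union_subset_union hsU htW, ?_⟩
      filter_upwards [hP, hQ] with y h1 h2 b hb
      exact hb.elim (h1 b) (h2 b)
    · intro a ha
      have h1 := h a ha
      rw [eventually_nhdsWithin_iff, nhds_prod_eq, eventually_prod_iff] at h1
      obtain ⟨p, hp, r, hr, hpr⟩ := h1
      obtain ⟨U, hUr, hU, haU⟩ := eventually_nhds_iff.1 hr
      refine ⟨U, mem_nhdsWithin_of_mem_nhds (hU.mem_nhds haU), U, hU, subset_rfl, ?_⟩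
      filter_upwards [hp] with y hy b hb hbΦ
      exact hpr hy (hUr b hb) hbΦ
  obtain ⟨U, hU, hxU, hP⟩ := key
  filter_upwards [hP, (hu U hU).mem_nhds hxU] with y hy hyU a ha
  exact hy a (hyU ha) ha

/-- Berge's theorem: minima of a lower semicontinuous function over the part of the fibres in a
closed set are lower semicontinuous. -/
lemma lowerSemicontinuous_biInf {Φ : X → Set A} (hc : ∀ x, IsCompact (Φ x))
    (hu : ∀ U : Set A, IsOpen U → IsOpen {x | Φ x ⊆ U}) {f : X × A → ℝ≥0∞}
    (hf : LowerSemicontinuousOn f {z : X × A | z.2 ∈ Φ z.1}) {F : Set A} (hF : IsClosed F) :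
    LowerSemicontinuous fun x => ⨅ a ∈ Φ x ∩ F, f (x, a) := by
  intro x t ht
  obtain ⟨s, hts, hs⟩ := exists_between ht
  have := eventually_forall_mem (hc x) hu (P := fun z => z.2 ∈ F → s < f z) ?_
  · filter_upwards [this] with y hy
    exact hts.trans_le (le_iInf₂ fun a ha => (hy a ha.1 ha.2).le)
  · intro a ha
    by_cases haF : a ∈ F
    · filter_upwards [hf (x, a) ha s (hs.trans_le (iInf₂_le a ⟨ha, haF⟩))] with z hz _ using hz
    · have : ∀ᶠ z : X × A in 𝓝 (x, a), z.2 ∉ F :=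
        continuous_snd.continuousAt.eventually (hF.isOpen_compl.mem_nhds (mem_compl haF))
      filter_upwards [this.filter_mono nhdsWithin_le_nhds] with z hz h using absurd h hz

/-- Berge's theorem for maxima of a continuous function. -/
lemma continuous_biSup {Φ : X → Set A} (hc : ∀ x, IsCompact (Φ x))
    (hu : ∀ U : Set A, IsOpen U → IsOpen {x | Φ x ⊆ U})
    (hl : ∀ U : Set A, IsOpen U → IsOpen {x | (Φ x ∩ U).Nonempty}) {f : X × A → ℝ≥0∞}
    (hf : ContinuousOn f {z : X × A | z.2 ∈ Φ z.1}) :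
    Continuous fun x => ⨆ a ∈ Φ x, f (x, a) := by
  rw [continuous_iff_lower_upperSemicontinuous]
  constructor
  · intro x t ht
    obtain ⟨a, ha⟩ := lt_iSup_iff.1 ht
    obtain ⟨haΦ, hat⟩ := lt_iSup_iff.1 ha
    have h1 := hf.lowerSemicontinuousOn (x, a) haΦ t hat
    rw [eventually_nhdsWithin_iff, nhds_prod_eq, eventually_prod_iff] at h1
    obtain ⟨p, hp, r, hr, hpr⟩ := h1
    obtain ⟨U, hUr, hU, haU⟩ := eventually_nhds_iff.1 hr
    filter_upwards [hp, (hl U hU).mem_nhds ⟨a, haΦ, haU⟩] with y hy hyU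
    obtain ⟨b, hbΦ, hbU⟩ := hyU
    exact (hpr hy (hUr b hbU) hbΦ).trans_le (le_iSup₂ (f := fun a _ => f (y, a)) b hbΦ)
  · intro x t ht
    obtain ⟨s, hs, hst⟩ := exists_between ht
    have := eventually_forall_mem (hc x) hu (P := fun z => f z < s) fun a ha =>
      hf.upperSemicontinuousOn (x, a) ha s ((le_iSup₂ (f := fun a _ => f (x, a)) a ha).trans_lt hs)
    filter_upwards [this] with y hy
    exact (iSup₂_le fun a ha => (hy a ha).le).trans_lt hst

lemma lowerSemicontinuousOn_fibre {Φ : X → Set A} {f : X × A → ℝ≥0∞}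
    (hf : LowerSemicontinuousOn f {z : X × A | z.2 ∈ Φ z.1}) (x : X) :
    LowerSemicontinuousOn (fun a => f (x, a)) (Φ x) := by
  have h : ContinuousOn (fun a : A => (x, a)) (Φ x) := by fun_prop
  exact hf.comp h fun a ha => ha

end Berge

/-! ### Measurable selection from compact-valued multifunctions -/

section Selection

variable {X A : Type*}

/-- The minimizers of `g` over the values of `Φ`. -/
def argminOn (Φ : X → Set A) (g : A → ℝ) (x : X) : Set A := {a ∈ Φ x | ∀ b ∈ Φ x, g a ≤ g b}

lemma argminOn_subset (Φ : X → Set A) (g : A → ℝ) (x : X) : argminOn Φ g x ⊆ Φ x :=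
  fun _ h => h.1

variable [MeasurableSpace X] [MetricSpace A]

/-- Measurability of multifunctions in the sense of hitting closed sets, together with nonempty
compact values. -/
structure IsCompactMeasurable (Φ : X → Set A) : Prop where
  nonempty : ∀ x, (Φ x).Nonempty
  isCompact : ∀ x, IsCompact (Φ x)
  measurableSet : ∀ F, IsClosed F → MeasurableSet {x | (Φ x ∩ F).Nonempty}

lemma IsCompactMeasurable.argminOn {Φ : X → Set A} (hΦ : IsCompactMeasurable Φ) {g : A → ℝ}
    (hg : Continuous g) : IsCompactMeasurable (argminOn Φ g) where
  nonempty x := by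
    obtain ⟨a, ha, hmin⟩ := (hΦ.isCompact x).exists_isMinOn (hΦ.nonempty x) hg.continuousOn
    exact ⟨a, ha, fun b hb => hmin hb⟩
  isCompact x := by
    have : MDP.argminOn Φ g x = Φ x ∩ ⋂ b ∈ Φ x, {a | g a ≤ g b} := by
      ext a; simp [MDP.argminOn]
    rw [this]
    exact (hΦ.isCompact x).inter_right
      (isClosed_biInter fun b _ => isClosed_le hg continuous_const)
  measurableSet F hF := by
    have hcl : ∀ r : ℝ, IsClosed {a | g a ≤ r} := fun r => isClosed_le hg continuous_const
    have : {x | (MDP.argminOn Φ g x ∩ F).Nonempty} = {x | (Φ x ∩ F).Nonempty} ∩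
        ⋂ r : ℚ, ({x | (Φ x ∩ {a | g a ≤ r}).Nonempty}ᶜ ∪
          {x | (Φ x ∩ (F ∩ {a | g a ≤ r})).Nonempty}) := by
      ext x
      simp only [mem_inter_iff, mem_iInter, mem_union, mem_compl_iff, mem_ofPred_eq]
      constructor
      · rintro ⟨a, ⟨ha, hmin⟩, haF⟩
        refine ⟨⟨a, ha, haF⟩, fun r => ?_⟩
        rw [or_iff_not_imp_left, not_not]
        rintro ⟨b, hb, hbr⟩
        exact ⟨a, ha, haF, (hmin b hb).trans hbr⟩
      · rintro ⟨hne, hr⟩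
        obtain ⟨a, ha, hmin⟩ :=
          ((hΦ.isCompact x).inter_right hF).exists_isMinOn hne hg.continuousOn
        refine ⟨a, ⟨ha.1, fun b hb => ?_⟩, ha.2⟩
        by_contra! hlt
        obtain ⟨r, hbr, hra⟩ := exists_rat_btwn hlt
        obtain ⟨d, hd, hdF, hdr⟩ := (hr r).resolve_left (not_not.2 ⟨b, hb, hbr.le⟩)
        have : g a ≤ g d := hmin ⟨hd, hdF⟩
        exact absurd (this.trans hdr) (not_le.2 hra)
    rw [this]
    refine (hΦ.measurableSet F hF).inter (MeasurableSet.iInter fun r => ?_)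
    exact (hΦ.measurableSet _ (hcl r)).compl.union (hΦ.measurableSet _ (hF.inter (hcl r)))

/-- A measurable selection theorem for compact-valued multifunctions. The selector picks the
lexicographic minimizer of the distances to the points of a dense sequence; these distances
separate points, so that the minimizer is unique. -/
lemma IsCompactMeasurable.exists_selector [SecondCountableTopology A] [MeasurableSpace A]
    [BorelSpace A] {Φ : X → Set A} (hΦ : IsCompactMeasurable Φ) :
    ∃ φ : X → A, Measurable φ ∧ ∀ x, φ x ∈ Φ x := by
  rcases isEmpty_or_nonempty A with hA | hA
  · have : IsEmpty X := ⟨fun x => hA.elim (hΦ.nonempty x).some⟩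
    exact ⟨fun x => this.elim x, measurable_of_empty _, fun x => this.elim x⟩
  let d : ℕ → A := TopologicalSpace.denseSeq A
  let Ψ : ℕ → X → Set A := fun n => Nat.rec Φ (fun n Θ => MDP.argminOn Θ fun a => dist a (d n)) n
  have hΨs : ∀ n, Ψ (n + 1) = MDP.argminOn (Ψ n) fun a => dist a (d n) := fun n => rfl
  have hΨ : ∀ n, IsCompactMeasurable (Ψ n) := by
    intro n
    induction n with
    | zero => exact hΦ
    | succ n ih => rw [hΨs]; exact ih.argminOn (by fun_prop)
  have hsub : ∀ n x, Ψ (n + 1) x ⊆ Ψ n x := fun n x => argminOn_subset _ _ x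
  have huniq : ∀ x a b, a ∈ ⋂ n, Ψ n x → b ∈ ⋂ n, Ψ n x → a = b := by
    intro x a b ha hb
    rw [mem_iInter] at ha hb
    have h : ∀ n, dist a (d n) = dist b (d n) := fun n =>
      le_antisymm ((ha (n + 1)).2 b (hb n)) ((hb (n + 1)).2 a (ha n))
    have heq : (fun y => dist a y) = fun y => dist b y :=
      Continuous.ext_on (TopologicalSpace.denseRange_denseSeq A) (by fun_prop) (by fun_prop)
        (forall_mem_range.2 h)
    simpa using congrFun heq b
  have hne : ∀ x F, IsClosed F → (∀ n, (Ψ n x ∩ F).Nonempty) →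
      ((⋂ n, Ψ n x) ∩ F).Nonempty := by
    intro x F hF h
    have := IsCompact.nonempty_iInter_of_sequence_nonempty_isCompact_isClosed
      (fun n => Ψ n x ∩ F) (fun n => inter_subset_inter_left _ (hsub n x)) h
      (((hΨ 0).isCompact x).inter_right hF) (fun n => ((hΨ n).isCompact x).isClosed.inter hF)
    rwa [← iInter_inter] at this
  choose φ hφ using fun x => (hne x univ isClosed_univ fun n => by
    simpa using (hΨ n).nonempty x)
  refine ⟨φ, measurable_of_isClosed fun F hF => ?_, fun x => mem_iInter.1 (hφ x).1 0⟩
  have : φ ⁻¹' F = ⋂ n, {x | (Ψ n x ∩ F).Nonempty} := by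
    ext x
    simp only [mem_preimage, mem_iInter, mem_ofPred_eq]
    constructor
    · exact fun h n => ⟨φ x, mem_iInter.1 (hφ x).1 n, h⟩
    · intro h
      obtain ⟨a, ha, haF⟩ := hne x F hF h
      rwa [huniq x _ _ (hφ x).1 ha]
  rw [this]
  exact MeasurableSet.iInter fun n => (hΨ n).measurableSet F hF

/-- Measurable selection of minimizers of a lower semicontinuous function. -/
lemma exists_measurable_argmin [TopologicalSpace X] [BorelSpace X]
    [SecondCountableTopology A] [MeasurableSpace A] [BorelSpace A]
    {Φ : X → Set A} (hne : ∀ x, (Φ x).Nonempty) (hc : ∀ x, IsCompact (Φ x))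
    (hu : ∀ U : Set A, IsOpen U → IsOpen {x | Φ x ⊆ U}) {f : X × A → ℝ≥0∞}
    (hf : LowerSemicontinuousOn f {z : X × A | z.2 ∈ Φ z.1}) :
    ∃ φ : X → A, Measurable φ ∧ ∀ x, φ x ∈ Φ x ∧ f (x, φ x) = ⨅ a ∈ Φ x, f (x, a) := by
  -- The minimizers hit a closed set `F` exactly when the minimum over the actions in `F` exists and
  -- does not exceed the overall minimum; both minima are semicontinuous in `x`.
  have hmin : ∀ x F, IsClosed F → (Φ x ∩ F).Nonempty →
      ∃ a ∈ Φ x ∩ F, f (x, a) = ⨅ b ∈ Φ x ∩ F, f (x, b) := by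
    intro x F hF h
    obtain ⟨a, ha, hm⟩ := LowerSemicontinuousOn.exists_isMinOn h ((hc x).inter_right hF)
      ((lowerSemicontinuousOn_fibre hf x).mono inter_subset_left)
    exact ⟨a, ha, le_antisymm (le_iInf₂ fun b hb => hm hb) (iInf₂_le a ha)⟩
  let m : X → ℝ≥0∞ := fun x => ⨅ a ∈ Φ x, f (x, a)
  have hm : Measurable m := by
    have := (lowerSemicontinuous_biInf hc hu hf isClosed_univ).measurable
    simpa only [inter_univ] using this
  have hΨ : IsCompactMeasurable fun x => {a ∈ Φ x | f (x, a) ≤ m x} := by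
    refine ⟨fun x => ?_, fun x => ?_, fun F hF => ?_⟩
    · obtain ⟨a, ha, h⟩ := hmin x univ isClosed_univ (by simpa using hne x)
      simp only [inter_univ] at ha h
      exact ⟨a, ha, h.le⟩
    · exact (lowerSemicontinuousOn_fibre hf x).isCompact_inter_preimage_Iic (hc x) _
    · have : {x | ({a ∈ Φ x | f (x, a) ≤ m x} ∩ F).Nonempty} =
          {x | Φ x ⊆ Fᶜ}ᶜ ∩ {x | ⨅ a ∈ Φ x ∩ F, f (x, a) ≤ m x} := by
        ext x
        simp only [mem_inter_iff, mem_compl_iff, mem_ofPred_eq]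
        rw [subset_compl_iff_disjoint_right, not_disjoint_iff_nonempty_inter]
        constructor
        · rintro ⟨a, ⟨ha, hle⟩, haF⟩
          exact ⟨⟨a, ha, haF⟩, (iInf₂_le a ⟨ha, haF⟩).trans hle⟩
        · rintro ⟨h, hle⟩
          obtain ⟨a, ha, hae⟩ := hmin x F hF h
          exact ⟨a, ⟨ha.1, hae.trans_le hle⟩, ha.2⟩
      rw [this]
      exact (hu _ hF.isOpen_compl).measurableSet.compl.inter
        (measurableSet_le (lowerSemicontinuous_biInf hc hu hf hF).measurable hm)
  obtain ⟨φ, hφ, h⟩ := hΨ.exists_selector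
  exact ⟨φ, hφ, fun x => ⟨(h x).1, le_antisymm (h x).2 (iInf₂_le _ (h x).1)⟩⟩

end Selection

/-! ### Integrals of semicontinuous functions against a weakly continuous kernel -/

section Approximation

variable {X : Type*} [PseudoMetricSpace X]

/-- The inf-convolution of `min u n` with `n` times the distance: the largest `n`-Lipschitz function
below `min u n`. -/
def infConv (u : X → ℝ≥0∞) (n : ℕ) (x : X) : ℝ≥0∞ := ⨅ y, min (u y) n + n * edist x y

lemma continuous_infConv (u : X → ℝ≥0∞) (n : ℕ) : Continuous (infConv u n) := by
  refine continuous_of_le_add_edist (n : ℝ≥0∞) (ENNReal.natCast_ne_top n) fun x y => ?_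
  rw [infConv, infConv, ENNReal.iInf_add]
  refine le_iInf fun w => (iInf_le _ w).trans ?_
  rw [add_assoc, ← mul_add]
  gcongr
  rw [add_comm]
  exact edist_triangle x y w

lemma infConv_le (u : X → ℝ≥0∞) (n : ℕ) (x : X) : infConv u n x ≤ min (u x) n :=
  (iInf_le _ x).trans (by simp)

lemma monotone_infConv (u : X → ℝ≥0∞) : Monotone (infConv u) := by
  intro m n h x
  have : (m : ℝ≥0∞) ≤ n := by exact_mod_cast h
  unfold infConv
  gcongr

/-- Lower semicontinuous functions are increasing limits of bounded continuous functions. -/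
lemma iSup_infConv {u : X → ℝ≥0∞} (hu : LowerSemicontinuous u) (x : X) :
    ⨆ n, infConv u n x = u x := by
  refine le_antisymm (iSup_le fun n => (infConv_le u n x).trans (min_le_left _ _)) ?_
  refine le_of_forall_lt fun t ht => ?_
  obtain ⟨s, hts, hsu⟩ := exists_between ht
  obtain ⟨ε, hε, hball⟩ := EMetric.mem_nhds_iff.1 (hu x s hsu)
  have hs : s ≠ ⊤ := hsu.ne_top
  obtain ⟨n, hn⟩ := ENNReal.exists_nat_gt (ENNReal.add_ne_top.2 ⟨hs,
    ENNReal.div_ne_top hs hε.ne'⟩)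
  refine hts.trans_le (le_iSup_of_le n (le_iInf fun y => ?_))
  by_cases hy : edist x y < ε
  · have h1 : s < u y := hball (by rwa [Metric.mem_eball, edist_comm])
    exact le_add_right (le_min h1.le (le_self_add.trans hn.le))
  · refine le_add_left ?_
    calc s ≤ s / ε * ε := by
          rcases eq_or_ne ε ⊤ with rfl | hε'
          · rcases eq_or_ne s 0 with rfl | h0
            · simp
            · have : edist x y = ⊤ := top_le_iff.1 (not_lt.1 hy)
              exact absurd this (edist_ne_top x y)
          · rw [ENNReal.div_mul_cancel hε.ne' hε']
      _ ≤ n * edist x y := by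
          gcongr
          · exact le_add_self.trans hn.le
          · exact not_lt.1 hy

end Approximation

section WeaklyContinuous

variable {X Z : Type*} [MetricSpace X] [MeasurableSpace X] [BorelSpace X]
  [TopologicalSpace Z] [MeasurableSpace Z] {q : Kernel Z X} [IsFiniteKernel q] {s : Set Z}

lemma continuousOn_lintegral_of_le
    (hq : ∀ f : BoundedContinuousFunction X ℝ, ContinuousOn (fun z => ∫ y, f y ∂(q z)) s)
    {u : X → ℝ≥0∞} (hu : Continuous u) {C : ℝ≥0} (hC : ∀ x, u x ≤ C) :
    ContinuousOn (fun z => ∫⁻ y, u y ∂(q z)) s := by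
  have hfin : ∀ x, u x ≠ ⊤ := fun x => ((hC x).trans_lt ENNReal.coe_lt_top).ne
  have hcont : Continuous fun x => (u x).toReal :=
    ENNReal.continuousOn_toReal.comp_continuous hu hfin
  have hle : ∀ x, (u x).toReal ≤ C := fun x => ENNReal.toReal_le_coe_of_le_coe (hC x)
  let f : BoundedContinuousFunction X ℝ := BoundedContinuousFunction.ofNormedAddCommGroup
    (fun x => (u x).toReal) hcont C fun x => by
      rw [Real.norm_of_nonneg ENNReal.toReal_nonneg]; exact hle x
  have h : ∀ z, ∫⁻ y, u y ∂(q z) = ENNReal.ofReal (∫ y, f y ∂(q z)) := by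
    intro z
    rw [ofReal_integral_eq_lintegral_ofReal (f.integrable _)
      (Eventually.of_forall fun x => ENNReal.toReal_nonneg)]
    refine lintegral_congr fun y => ?_
    exact (ENNReal.ofReal_toReal (hfin y)).symm
  simp_rw [h]
  exact ENNReal.continuous_ofReal.comp_continuousOn (hq f)

/-- The integrals of a nonnegative lower semicontinuous function against a weakly continuous kernel
depend lower semicontinuously on the parameter. -/
lemma lowerSemicontinuousOn_lintegral
    (hq : ∀ f : BoundedContinuousFunction X ℝ, ContinuousOn (fun z => ∫ y, f y ∂(q z)) s)
    {u : X → ℝ≥0∞} (hu : LowerSemicontinuous u) :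
    LowerSemicontinuousOn (fun z => ∫⁻ y, u y ∂(q z)) s := by
  have h : (fun z => ∫⁻ y, u y ∂(q z)) = fun z => ⨆ n, ∫⁻ y, infConv u n y ∂(q z) := by
    funext z
    rw [← lintegral_iSup (fun n => (continuous_infConv u n).measurable) (monotone_infConv u)]
    simp_rw [iSup_infConv hu]
  rw [h]
  refine lowerSemicontinuousOn_iSup fun n => ContinuousOn.lowerSemicontinuousOn ?_
  exact continuousOn_lintegral_of_le hq (continuous_infConv u n) (C := n)
    fun x => by simpa using (infConv_le u n x).trans (min_le_right _ _)

/-- If integrals of `w` are continuous in the parameter, so are those of every continuous function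
dominated by `w`: both `∫ u` and `∫ (w - u)` are lower semicontinuous. -/
lemma continuousOn_lintegral_of_le_weight
    (hq : ∀ f : BoundedContinuousFunction X ℝ, ContinuousOn (fun z => ∫ y, f y ∂(q z)) s)
    {w : X → ℝ≥0} (hw : Continuous w) (hqw : ContinuousOn (fun z => ∫⁻ y, w y ∂(q z)) s)
    (hfin : ∀ z ∈ s, ∫⁻ y, w y ∂(q z) ≠ ⊤) {u : X → ℝ≥0∞} (hu : Continuous u)
    (huw : ∀ x, u x ≤ w x) :
    ContinuousOn (fun z => ∫⁻ y, u y ∂(q z)) s := by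
  have hw' : Continuous fun y => (w y : ℝ≥0∞) := ENNReal.continuous_coe.comp hw
  have hd : Continuous fun y => (w y : ℝ≥0∞) - u y := by
    refine continuous_iff_continuousAt.2 fun y => ?_
    exact ENNReal.Tendsto.sub hw'.continuousAt hu.continuousAt (Or.inl ENNReal.coe_ne_top)
  have hl := lowerSemicontinuousOn_lintegral hq hu.lowerSemicontinuous
  have hl' := lowerSemicontinuousOn_lintegral hq hd.lowerSemicontinuous
  have hadd : ∀ z, ∫⁻ y, u y ∂(q z) + ∫⁻ y, (w y - u y) ∂(q z) = ∫⁻ y, w y ∂(q z) := by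
    intro z
    rw [← lintegral_add_left hu.measurable]
    exact lintegral_congr fun y => add_tsub_cancel_of_le (huw y)
  have hle : ∀ z, ∫⁻ y, (w y - u y) ∂(q z) ≤ ∫⁻ y, w y ∂(q z) := fun z =>
    (le_add_left le_rfl).trans (hadd z).le
  intro z hz
  refine continuousWithinAt_iff_lower_upperSemicontinuousWithinAt.2 ⟨hl z hz, ?_⟩
  intro t ht
  obtain ⟨r, hr, hrt⟩ := exists_between ht
  obtain ⟨r', hr', hrr⟩ := exists_between hr
  set l := ∫⁻ y, (w y - u y) ∂(q z) - (r - r') with hldef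
  have hLfin : ∫⁻ y, (w y - u y) ∂(q z) ≠ ⊤ := ne_top_of_le_ne_top (hfin z hz) (hle z)
  have hlfin : l ≠ ⊤ := ENNReal.sub_ne_top hLfin
  have hev : ∀ᶠ z' in 𝓝[s] z, l ≤ ∫⁻ y, (w y - u y) ∂(q z') := by
    rcases eq_or_ne l 0 with h0 | h0
    · exact Eventually.of_forall fun z' => h0 ▸ zero_le
    · refine (hl' z hz l (ENNReal.sub_lt_self hLfin ?_ (tsub_pos_of_lt hrr).ne')).mono
        fun z' h => h.le
      rintro h
      simp [hldef, h] at h0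
  have hW : ∫⁻ y, w y ∂(q z) < r + l := by
    calc ∫⁻ y, w y ∂(q z) = ∫⁻ y, u y ∂(q z) + ∫⁻ y, (w y - u y) ∂(q z) := (hadd z).symm
      _ < r' + ∫⁻ y, (w y - u y) ∂(q z) := ENNReal.add_lt_add_right hLfin hr'
      _ ≤ r' + ((r - r') + l) := by gcongr; exact le_add_tsub
      _ = r + l := by rw [← add_assoc, add_tsub_cancel_of_le hrr.le]
  filter_upwards [hev, (hqw z hz).eventually (Iio_mem_nhds hW)] with z' h1 h2
  refine lt_trans ?_ hrt
  have h3 : ∫⁻ y, u y ∂(q z') + l < r + l := by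
    refine lt_of_le_of_lt ?_ h2
    rw [← hadd z']
    gcongr
  exact lt_of_add_lt_add_right h3

end WeaklyContinuous

/-! ### Expectations along trajectories -/

section Trajectories

variable {X A : Type*} [MeasurableSpace X] [MeasurableSpace A] {M : MDP X A}

instance instIsFiniteKernelQ (M : MDP X A) : IsFiniteKernel M.q := M.finite_q

instance instIsMarkovKernelRule (π : M.Policy) (n : ℕ) : IsMarkovKernel (π.rule n) := π.markov n

lemma measurableSet_graph' (M : MDP X A) : MeasurableSet M.graph := M.measurableSet_graph

/-- The normalization of `q` is undone by the factor `α`, also where `α` vanishes. -/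
lemma mass_mul_lintegral_p (M : MDP X A) (z : X × A) (h : X → ℝ≥0∞) :
    M.mass z * ∫⁻ y, h y ∂(M.p z) = ∫⁻ y, h y ∂(M.q z) := by
  by_cases h0 : M.mass z = 0
  · have : M.q z = 0 := Measure.measure_univ_eq_zero.1 h0
    simp [h0, this]
  · have : M.p z = (M.mass z)⁻¹ • M.q z := if_neg h0
    rw [this, lintegral_smul_measure, smul_eq_mul, ← mul_assoc,
      ENNReal.mul_inv_cancel h0 (measure_ne_top _ _), one_mul]

lemma Policy.lintegral_step (π : M.Policy) (m : ℕ) (g : Π _ : Finset.Iic m, X × A)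
    {h : X × A → ℝ≥0∞} (hh : Measurable h) :
    ∫⁻ z, h z ∂(π.step m g) = ∫⁻ y, ∫⁻ a, h (y, a) ∂(π.rule (m + 1)
      (fun i : Fin (m + 1) => g ⟨i, Finset.mem_Iic.2 (Nat.lt_succ_iff.1 i.2)⟩, y))
      ∂(M.p (g ⟨m, Finset.mem_Iic.2 le_rfl⟩)) := by
  rw [Policy.step, Kernel.lintegral_compProd _ _ _ hh]
  rfl

lemma Policy.lintegral_traj_zero (π : M.Policy) (x : X) {h : X × A → ℝ≥0∞} (hh : Measurable h) :
    ∫⁻ ω, h (ω 0) ∂(π.traj x) = ∫⁻ a, h (x, a) ∂(π.rule 0 (Fin.elim0, x)) := by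
  have hm : Measurable fun a : A => (x, a) := measurable_prodMk_left
  have key : (π.traj x).map (Preorder.frestrictLe 0) =
      ((π.rule 0 (Fin.elim0, x)).map (fun a => (x, a))).map
        (MeasurableEquiv.piUnique fun _ : Finset.Iic 0 => X × A).symm := by
    rw [Policy.traj, Kernel.trajMeasure, Measure.map_comp _ _ (by fun_prop),
      Kernel.traj_map_frestrictLe, Kernel.partialTraj_self, Measure.id_comp]
  have h1 : ∫⁻ ω, h (ω 0) ∂(π.traj x) = ∫⁻ g, h (g ⟨0, Finset.mem_Iic.2 le_rfl⟩)
      ∂((π.traj x).map (Preorder.frestrictLe 0)) := by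
    rw [lintegral_map (by fun_prop) (by fun_prop)]
    rfl
  rw [h1, key, lintegral_map (by fun_prop) (by fun_prop), lintegral_map (by fun_prop) hm]
  rfl

instance (π : M.Policy) (x : X) : IsProbabilityMeasure
    ((π.rule 0 (Fin.elim0, x)).map (fun a => (x, a))) :=
  Measure.isProbabilityMeasure_map measurable_prodMk_left.aemeasurable

/-- The Markov property of trajectories. -/
lemma Policy.lintegral_traj_succ (π : M.Policy) (x : X) (m : ℕ)
    {G : (Π _ : Finset.Iic m, X × A) → ℝ≥0∞} (hG : Measurable G)
    {h : X × A → ℝ≥0∞} (hh : Measurable h) :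
    ∫⁻ ω, G (Preorder.frestrictLe m ω) * h (ω (m + 1)) ∂(π.traj x) =
      ∫⁻ ω, G (Preorder.frestrictLe m ω) * ∫⁻ z, h z ∂(π.step m (Preorder.frestrictLe m ω))
        ∂(π.traj x) := by
  have key := Kernel.map_frestrictLe_trajMeasure_compProd_eq_map_trajMeasure
    (X := fun _ => X × A) (μ₀ := (π.rule 0 (Fin.elim0, x)).map (fun a => (x, a)))
    (κ := π.step) (a := m)
  have hGh : Measurable fun gz : (Π _ : Finset.Iic m, X × A) × (X × A) => G gz.1 * h gz.2 := by
    fun_prop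
  have h1 : ∫⁻ ω, G (Preorder.frestrictLe m ω) * h (ω (m + 1)) ∂(π.traj x) =
      ∫⁻ gz, G gz.1 * h gz.2
        ∂((π.traj x).map fun ω => (Preorder.frestrictLe m ω, ω (m + 1))) := by
    rw [lintegral_map hGh (by fun_prop)]
  rw [h1, Policy.traj, ← key, Measure.lintegral_compProd hGh,
    lintegral_map (hGh.lintegral_kernel_prod_right') (by fun_prop)]
  refine lintegral_congr fun ω => ?_
  exact lintegral_const_mul (G (Preorder.frestrictLe m ω)) hh

variable (M) in
/-- The discount accumulated before epoch `m`. -/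
def discount (m : ℕ) (ω : ℕ → X × A) : ℝ≥0∞ := ∏ k ∈ Finset.range m, M.mass (ω k)

lemma measurable_discount (m : ℕ) : Measurable (M.discount m) :=
  Finset.measurable_fun_prod _ fun k _ => M.measurable_mass.comp (measurable_pi_apply k)

lemma Policy.lintegral_discount_succ' (π : M.Policy) (x : X) (m : ℕ)
    {h : X × A → ℝ≥0∞} (hh : Measurable h) :
    ∫⁻ ω, M.discount (m + 1) ω * h (ω (m + 1)) ∂(π.traj x) =
      ∫⁻ ω, M.discount (m + 1) ω * ∫⁻ z, h z ∂(π.step m (Preorder.frestrictLe m ω))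
        ∂(π.traj x) := by
  have hG : Measurable fun g : Π _ : Finset.Iic m, X × A => ∏ k : Fin (m + 1),
      M.mass (g ⟨k, Finset.mem_Iic.2 (Nat.lt_succ_iff.1 k.2)⟩) :=
    Finset.measurable_fun_prod _ fun k _ => M.measurable_mass.comp (measurable_pi_apply _)
  have hw : ∀ ω : ℕ → X × A, M.discount (m + 1) ω = (fun g : Π _ : Finset.Iic m, X × A =>
      ∏ k : Fin (m + 1), M.mass (g ⟨k, Finset.mem_Iic.2 (Nat.lt_succ_iff.1 k.2)⟩))
        (Preorder.frestrictLe m ω) := fun ω => Finset.prod_range fun k => M.mass (ω k)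
  simp_rw [hw]
  exact π.lintegral_traj_succ x m hG hh

/-- One step of the discounted expectations: the next state is integrated out with `q`. -/
lemma Policy.lintegral_discount_succ (π : M.Policy) (x : X) (m : ℕ)
    {h : X → ℝ≥0∞} (hh : Measurable h) :
    ∫⁻ ω, M.discount (m + 1) ω * h (ω (m + 1)).1 ∂(π.traj x) =
      ∫⁻ ω, M.discount m ω * ∫⁻ y, h y ∂(M.q (ω m)) ∂(π.traj x) := by
  have hh' : Measurable fun z : X × A => h z.1 := hh.comp measurable_fst
  rw [π.lintegral_discount_succ' x m hh']
  refine lintegral_congr fun ω => ?_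
  rw [π.lintegral_step m _ hh', ← M.mass_mul_lintegral_p, ← mul_assoc]
  simp only [lintegral_const, measure_univ, mul_one]
  rw [discount, Finset.prod_range_succ]
  rfl

lemma Policy.ae_mem_graph (π : M.Policy) (x : X) (m : ℕ) : ∀ᵐ ω ∂(π.traj x), ω m ∈ M.graph := by
  have hind : Measurable (M.graphᶜ.indicator (1 : X × A → ℝ≥0∞)) :=
    measurable_one.indicator M.measurableSet_graph'.compl
  have hrule : ∀ n (h : Hist X A n),
      ∫⁻ a, M.graphᶜ.indicator (1 : X × A → ℝ≥0∞) (h.2, a) ∂(π.rule n h) = 0 := by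
    intro n h
    have hs : MeasurableSet (M.act h.2) :=
      measurable_prodMk_left (x := h.2) M.measurableSet_graph
    have : ∀ a, M.graphᶜ.indicator (1 : X × A → ℝ≥0∞) (h.2, a) =
        (M.act h.2)ᶜ.indicator 1 a := fun a => rfl
    simp_rw [this]
    rw [lintegral_indicator_one hs.compl, prob_compl_eq_zero_iff hs]
    exact π.feasible n h
  have hzero : ∫⁻ ω, M.graphᶜ.indicator (1 : X × A → ℝ≥0∞) (ω m) ∂(π.traj x) = 0 := by
    cases m with
    | zero => rw [π.lintegral_traj_zero x hind]; exact hrule 0 (Fin.elim0, x)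
    | succ m =>
      have := π.lintegral_traj_succ x m (G := fun _ => 1) measurable_const hind
      simp only [one_mul] at this
      rw [this]
      simp_rw [π.lintegral_step m _ hind]
      refine lintegral_eq_zero_of_ae_eq_zero (Eventually.of_forall fun ω => ?_)
      refine lintegral_eq_zero_of_ae_eq_zero (Eventually.of_forall fun y => ?_)
      exact hrule (m + 1) (_, y)
  have hmeas : Measurable fun ω : ℕ → X × A => M.graphᶜ.indicator (1 : X × A → ℝ≥0∞) (ω m) :=
    hind.comp (measurable_pi_apply m)
  rw [lintegral_eq_zero_iff hmeas] at hzero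
  filter_upwards [hzero] with ω hω
  by_contra hn
  simp [indicator_of_mem (mem_compl hn)] at hω

lemma Policy.cost_eq_tsum (π : M.Policy) (x : X) :
    π.cost x = ∑' n, ∫⁻ ω, M.discount n ω * M.c (ω n) ∂(π.traj x) :=
  lintegral_tsum fun n => ((measurable_discount n).mul
    (M.measurable_c.comp (measurable_pi_apply n)).coe_nnreal_ennreal).aemeasurable

/-- A lower bound for the cost of every policy, by comparison with a sequence that grows no faster
than value iteration started from zero. -/
lemma Policy.le_cost {u : ℕ → X → ℝ≥0∞} (hu : ∀ n, Measurable (u n)) (h0 : u 0 = 0)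
    (hsucc : ∀ n x, ∀ a ∈ M.act x, u (n + 1) x ≤ M.c (x, a) + ∫⁻ y, u n y ∂(M.q (x, a)))
    (π : M.Policy) (n : ℕ) (x : X) : u n x ≤ π.cost x := by
  have hcm : ∀ m, Measurable fun ω : ℕ → X × A => M.discount m ω * (M.c (ω m) : ℝ≥0∞) := fun m =>
    (measurable_discount m).mul (M.measurable_c.comp (measurable_pi_apply m)).coe_nnreal_ennreal
  -- Play `π` for `m` epochs and collect the terminal cost `u j`.
  have key : ∀ m j, u (m + j) x ≤
      ∑ k ∈ Finset.range m, ∫⁻ ω, M.discount k ω * M.c (ω k) ∂(π.traj x) +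
        ∫⁻ ω, M.discount m ω * u j (ω m).1 ∂(π.traj x) := by
    intro m
    induction m with
    | zero =>
      intro j
      simp only [discount, Finset.range_zero, Finset.prod_empty, one_mul, Finset.sum_empty, zero_add]
      rw [π.lintegral_traj_zero x (h := fun z => u j z.1) ((hu j).comp measurable_fst)]
      simp
    | succ m ih =>
      intro j
      have hmj : m + 1 + j = m + (j + 1) := by ring
      rw [hmj, Finset.sum_range_succ, add_assoc (Finset.sum (Finset.range m) _),
        π.lintegral_discount_succ x m (hu j), ← lintegral_add_left (hcm m)]
      refine (ih (j + 1)).trans ?_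
      gcongr ?_ + ?_
      · exact le_rfl
      refine lintegral_mono_ae ?_
      filter_upwards [π.ae_mem_graph x m] with ω hω
      rw [← mul_add]
      gcongr
      exact hsucc j (ω m).1 (ω m).2 hω
  have := key n 0
  simp only [h0, Pi.zero_apply, mul_zero, lintegral_zero, add_zero] at this
  rw [π.cost_eq_tsum]
  exact this.trans (ENNReal.sum_le_tsum _)

lemma Stationary.measurable_Q (φ : M.Stationary) {u : X → ℝ≥0∞} (hu : Measurable u) :
    Measurable (φ.Q u) :=
  (Measurable.lintegral_kernel hu).comp (measurable_id.prodMk φ.measurable)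

lemma Stationary.measurable_iterate_Q (φ : M.Stationary) {u : X → ℝ≥0∞} (hu : Measurable u)
    (n : ℕ) : Measurable (φ.Q^[n] u) := by
  induction n with
  | zero => exact hu
  | succ n ih => rw [Function.iterate_succ_apply']; exact φ.measurable_Q ih

lemma Stationary.measurable_c (φ : M.Stationary) : Measurable φ.c :=
  (M.measurable_c.comp (measurable_id.prodMk φ.measurable)).coe_nnreal_ennreal

/-- Under a stationary policy the action at epoch `m` may be replaced by its prescribed value. -/
lemma Stationary.lintegral_discount (φ : M.Stationary) (x : X) (m : ℕ) {h : X × A → ℝ≥0∞}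
    (hh : Measurable h) :
    ∫⁻ ω, M.discount m ω * h (ω m) ∂(φ.toPolicy.traj x) =
      ∫⁻ ω, M.discount m ω * h ((ω m).1, φ.toFun (ω m).1) ∂(φ.toPolicy.traj x) := by
  have hφ : Measurable fun y : X => h (y, φ.toFun y) :=
    hh.comp (measurable_id.prodMk φ.measurable)
  have hh' : Measurable fun z : X × A => h (z.1, φ.toFun z.1) := hφ.comp measurable_fst
  have hrule : ∀ n (g : Hist X A n) {f : A → ℝ≥0∞}, Measurable f →
      ∫⁻ a, f a ∂(φ.toPolicy.rule n g) = f (φ.toFun g.2) := fun n g f hf =>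
    Kernel.lintegral_deterministic' (φ.measurable.comp measurable_snd) hf
  have hy : ∀ y, Measurable fun a => h (y, a) := fun y => hh.comp measurable_prodMk_left
  cases m with
  | zero =>
    simp only [discount, Finset.range_zero, Finset.prod_empty, one_mul]
    rw [Policy.lintegral_traj_zero _ x hh, Policy.lintegral_traj_zero _ x hh',
      hrule _ _ (hy x)]
    simp
  | succ m =>
    rw [Policy.lintegral_discount_succ' _ x m hh, Policy.lintegral_discount_succ' _ x m hh']
    refine lintegral_congr fun ω => ?_
    rw [Policy.lintegral_step _ m _ hh, Policy.lintegral_step _ m _ hh']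
    congr 1
    refine lintegral_congr fun y => ?_
    rw [hrule _ _ (hy y)]
    simp

lemma Stationary.lintegral_discount_eq_iterate (φ : M.Stationary) (x : X) (m : ℕ) :
    ∀ {h : X → ℝ≥0∞}, Measurable h →
      ∫⁻ ω, M.discount m ω * h (ω m).1 ∂(φ.toPolicy.traj x) = φ.Q^[m] h x := by
  induction m with
  | zero =>
    intro h hh
    simp only [discount, Finset.range_zero, Finset.prod_empty, one_mul, Function.iterate_zero, id]
    rw [Policy.lintegral_traj_zero _ x (h := fun z => h z.1) (hh.comp measurable_fst)]
    simp
  | succ m ih =>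
    intro h hh
    rw [Policy.lintegral_discount_succ _ x m hh, φ.lintegral_discount x m hh.lintegral_kernel,
      Function.iterate_succ_apply]
    exact ih (φ.measurable_Q hh)

/-- The cost of a stationary policy. -/
lemma Stationary.cost_eq (φ : M.Stationary) (x : X) :
    φ.toPolicy.cost x = ∑' n, φ.Q^[n] φ.c x := by
  rw [Policy.cost_eq_tsum]
  refine tsum_congr fun n => ?_
  rw [φ.lintegral_discount x n (h := fun z => (M.c z : ℝ≥0∞)) M.measurable_c.coe_nnreal_ennreal]
  exact φ.lintegral_discount_eq_iterate x n φ.measurable_c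

lemma Stationary.Q_mono (φ : M.Stationary) {u w : X → ℝ≥0∞} (h : u ≤ w) : φ.Q u ≤ φ.Q w :=
  fun _ => lintegral_mono h

lemma Stationary.Q_add (φ : M.Stationary) {u : X → ℝ≥0∞} (hu : Measurable u) (w : X → ℝ≥0∞) :
    φ.Q (u + w) = φ.Q u + φ.Q w :=
  funext fun _ => lintegral_add_left hu w

lemma Stationary.Q_const_mul (φ : M.Stationary) {u : X → ℝ≥0∞} (hu : Measurable u) (r : ℝ≥0∞) :
    (φ.Q fun y => r * u y) = fun x => r * φ.Q u x :=
  funext fun _ => lintegral_const_mul r hu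

/-- The cost of a stationary policy solves the policy evaluation equation. -/
lemma Stationary.cost_eq_add (φ : M.Stationary) (x : X) :
    φ.toPolicy.cost x = φ.c x + φ.Q φ.toPolicy.cost x := by
  have h : φ.toPolicy.cost = fun x => ∑' n, φ.Q^[n] φ.c x := funext φ.cost_eq
  rw [h, Stationary.Q,
    lintegral_tsum fun n => (φ.measurable_iterate_Q φ.measurable_c n).aemeasurable]
  refine (tsum_eq_zero_add' (f := fun n => φ.Q^[n] φ.c x) ENNReal.summable).trans ?_
  congr 1
  refine tsum_congr fun n => ?_
  rw [Function.iterate_succ_apply']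
  rfl

/-- The cost of a stationary policy is the least solution of the policy evaluation inequality. -/
lemma Stationary.cost_le (φ : M.Stationary) {u : X → ℝ≥0∞}
    (h : ∀ x, φ.c x + φ.Q u x ≤ u x) (x : X) : φ.toPolicy.cost x ≤ u x := by
  rw [φ.cost_eq, ENNReal.tsum_eq_iSup_nat]
  refine iSup_le fun n => ?_
  induction n generalizing x with
  | zero => simp
  | succ n ih =>
    rw [Finset.sum_range_succ']
    refine le_trans ?_ (h x)
    rw [add_comm]
    gcongr ?_ + ?_
    · exact le_rfl
    · have : ∑ k ∈ Finset.range n, φ.Q^[k + 1] φ.c x =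
          φ.Q (fun y => ∑ k ∈ Finset.range n, φ.Q^[k] φ.c y) x := by
        rw [Stationary.Q, lintegral_finsetSum _
          fun k _ => φ.measurable_iterate_Q φ.measurable_c k]
        refine Finset.sum_congr rfl fun k _ => ?_
        rw [Function.iterate_succ_apply']
        rfl
      rw [this]
      exact φ.Q_mono ih x

end Trajectories

/-! ### Value iteration and the optimality equation -/

section Bellman

variable {X A : Type*} [MeasurableSpace X] [MeasurableSpace A] (M : MDP X A)

/-- The optimality operator on `[0, ∞]`-valued functions. -/
def bellman (u : X → ℝ≥0∞) (x : X) : ℝ≥0∞ :=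
  ⨅ a ∈ M.act x, ((M.c (x, a) : ℝ≥0∞) + ∫⁻ y, u y ∂(M.q (x, a)))

/-- The iterates of the optimality operator from zero: the optimal finite-horizon costs. -/
def valueIter (n : ℕ) : X → ℝ≥0∞ := M.bellman^[n] 0

variable {M}

lemma bellman_le {u : X → ℝ≥0∞} {x : X} {a : A} (ha : a ∈ M.act x) :
    M.bellman u x ≤ M.c (x, a) + ∫⁻ y, u y ∂(M.q (x, a)) :=
  iInf₂_le a ha

lemma bellman_mono : Monotone M.bellman := fun u w h x => by
  unfold bellman
  gcongr with a ha
  exact h _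

lemma valueIter_succ (n : ℕ) : M.valueIter (n + 1) = M.bellman (M.valueIter n) :=
  Function.iterate_succ_apply' _ _ _

lemma monotone_valueIter : Monotone M.valueIter :=
  bellman_mono.monotone_iterate_of_le_map (fun _ => zero_le)

lemma valueIter_le_cost (hm : ∀ n, Measurable (M.valueIter n)) (π : M.Policy) (n : ℕ) (x : X) :
    M.valueIter n x ≤ π.cost x :=
  π.le_cost hm rfl (fun n x a ha => by rw [valueIter_succ]; exact bellman_le ha) n x

lemma iSup_valueIter_le_value (hm : ∀ n, Measurable (M.valueIter n)) (x : X) :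
    ⨆ n, M.valueIter n x ≤ M.value x :=
  iSup_le fun n => le_iInf fun π => valueIter_le_cost hm π n x

lemma value_le (π : M.Policy) (x : X) : M.value x ≤ π.cost x := iInf_le _ π

lemma Stationary.isOptimal_iff (φ : M.Stationary) :
    φ.toPolicy.IsOptimal ↔ ∀ x, M.value x = φ.c x + φ.Q M.value x := by
  constructor
  · intro h x
    have : φ.toPolicy.cost = M.value := funext h
    rw [← this]
    exact φ.cost_eq_add x
  · exact fun h x => le_antisymm (φ.cost_le (fun y => (h y).ge) x) (value_le _ x)

end Bellman

section Optimality

variable {X A : Type*} [MetricSpace X] [MeasurableSpace X] [BorelSpace X]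
  [MetricSpace A] [MeasurableSpace A] {M : MDP X A}

lemma AssumptionWC.lowerSemicontinuousOn_bellman (hWC : M.AssumptionWC) {u : X → ℝ≥0∞}
    (hu : LowerSemicontinuous u) :
    LowerSemicontinuousOn (fun z => (M.c z : ℝ≥0∞) + ∫⁻ y, u y ∂(M.q z)) M.graph :=
  (ENNReal.continuous_coe.comp_lowerSemicontinuousOn hWC.lsc_c ENNReal.coe_mono).add
    (lowerSemicontinuousOn_lintegral hWC.weak_continuous hu)

lemma AssumptionWC.lowerSemicontinuous_valueIter (hWC : M.AssumptionWC) (n : ℕ) :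
    LowerSemicontinuous (M.valueIter n) := by
  induction n with
  | zero => exact lowerSemicontinuous_const
  | succ n ih =>
    rw [valueIter_succ]
    have := lowerSemicontinuous_biInf hWC.isCompact_act hWC.isOpen_subset
      (hWC.lowerSemicontinuousOn_bellman ih) isClosed_univ
    simp only [inter_univ] at this
    exact this

lemma AssumptionWC.measurable_valueIter (hWC : M.AssumptionWC) (n : ℕ) :
    Measurable (M.valueIter n) :=
  (hWC.lowerSemicontinuous_valueIter n).measurable

lemma AssumptionWC.lowerSemicontinuous_iSup_valueIter (hWC : M.AssumptionWC) :
    LowerSemicontinuous fun x => ⨆ n, M.valueIter n x :=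
  lowerSemicontinuous_iSup fun n => hWC.lowerSemicontinuous_valueIter n

/-- The limit of value iteration solves the optimality equation: the sets of actions whose
finite-horizon costs stay below the limit are compact, nonempty and decreasing, and a common element
serves in the limit. -/
lemma AssumptionWC.bellman_iSup_valueIter (hWC : M.AssumptionWC) :
    M.bellman (fun x => ⨆ n, M.valueIter n x) = fun x => ⨆ n, M.valueIter n x := by
  funext x
  refine le_antisymm ?_ (iSup_le fun n => ?_)
  · set t := ⨆ n, M.valueIter n x with ht
    let f : ℕ → A → ℝ≥0∞ := fun n a => M.c (x, a) + ∫⁻ y, M.valueIter n y ∂(M.q (x, a))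
    have hf : ∀ n, LowerSemicontinuousOn (f n) (M.act x) := fun n =>
      lowerSemicontinuousOn_fibre
        (hWC.lowerSemicontinuousOn_bellman (hWC.lowerSemicontinuous_valueIter n)) x
    have hcomp : ∀ n, IsCompact (M.act x ∩ f n ⁻¹' Iic t) := fun n =>
      (hf n).isCompact_inter_preimage_Iic (hWC.isCompact_act x) t
    obtain ⟨a, ha⟩ := IsCompact.nonempty_iInter_of_sequence_nonempty_isCompact_isClosed
      (fun n => M.act x ∩ f n ⁻¹' Iic t)
      (fun n a ha => ⟨ha.1, le_trans (add_le_add_right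
        (lintegral_mono fun y => monotone_valueIter n.le_succ y) _) ha.2⟩)
      (fun n => by
        obtain ⟨a, ha, hmin⟩ := (hf n).exists_isMinOn (M.act_nonempty x) (hWC.isCompact_act x)
        refine ⟨a, ha, le_trans (b := ⨅ b ∈ M.act x, f n b) (le_iInf₂ fun b hb => hmin hb) ?_⟩
        rw [ht]
        refine le_trans (le_of_eq ?_) (le_iSup _ (n + 1))
        rw [valueIter_succ]
        rfl)
      (hcomp 0) (fun n => (hcomp n).isClosed)
    rw [mem_iInter] at ha
    refine (bellman_le (ha 0).1).trans ?_
    rw [lintegral_iSup (fun n => hWC.measurable_valueIter n) monotone_valueIter, ENNReal.add_iSup]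
    exact iSup_le fun n => (ha n).2
  · refine (monotone_valueIter n.le_succ x).trans ?_
    rw [valueIter_succ]
    exact bellman_mono (fun y => le_iSup (fun n => M.valueIter n y) n) x

variable [SecondCountableTopology A] [BorelSpace A]

lemma AssumptionWC.exists_stationary_bellman (hWC : M.AssumptionWC) {u : X → ℝ≥0∞}
    (hu : LowerSemicontinuous u) :
    ∃ φ : M.Stationary, ∀ x, φ.c x + φ.Q u x = M.bellman u x := by
  obtain ⟨φ, hφ, h⟩ := exists_measurable_argmin M.act_nonempty hWC.isCompact_act
    hWC.isOpen_subset (hWC.lowerSemicontinuousOn_bellman hu)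
  exact ⟨⟨φ, hφ, fun x => (h x).1⟩, fun x => (h x).2⟩

/-- Value iteration from zero converges to the value function. -/
lemma AssumptionWC.value_eq (hWC : M.AssumptionWC) :
    M.value = fun x => ⨆ n, M.valueIter n x := by
  obtain ⟨φ, hφ⟩ := hWC.exists_stationary_bellman hWC.lowerSemicontinuous_iSup_valueIter
  rw [hWC.bellman_iSup_valueIter] at hφ
  funext x
  exact le_antisymm ((value_le _ x).trans (φ.cost_le (fun x => (hφ x).le) x))
    (iSup_valueIter_le_value hWC.measurable_valueIter x)

lemma AssumptionWC.lowerSemicontinuous_value (hWC : M.AssumptionWC) :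
    LowerSemicontinuous M.value :=
  hWC.value_eq ▸ hWC.lowerSemicontinuous_iSup_valueIter

lemma AssumptionWC.bellman_value (hWC : M.AssumptionWC) : M.bellman M.value = M.value := by
  rw [hWC.value_eq, hWC.bellman_iSup_valueIter]

lemma AssumptionWC.exists_optimal (hWC : M.AssumptionWC) :
    ∃ φ : M.Stationary, φ.toPolicy.IsOptimal := by
  obtain ⟨φ, hφ⟩ := hWC.exists_stationary_bellman hWC.lowerSemicontinuous_value
  rw [hWC.bellman_value] at hφ
  exact ⟨φ, φ.isOptimal_iff.2 fun x => (hφ x).symm⟩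

lemma AssumptionWC.isLeast_value (hWC : M.AssumptionWC) (x : X) :
    IsLeast ((fun a => (M.c (x, a) : ℝ≥0∞) + ∫⁻ y, M.value y ∂(M.q (x, a))) '' M.act x)
      (M.value x) := by
  obtain ⟨φ, hφ⟩ := hWC.exists_stationary_bellman hWC.lowerSemicontinuous_value
  rw [hWC.bellman_value] at hφ
  refine ⟨⟨φ.toFun x, φ.feasible x, hφ x⟩, ?_⟩
  rintro _ ⟨a, ha, rfl⟩
  exact (congrFun hWC.bellman_value x).symm.le.trans (bellman_le ha)

end Optimality

/-! ### Existence of a continuous excessive weight -/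

section MaxOperator

variable {X A : Type*} [MeasurableSpace X] [MeasurableSpace A] (M : MDP X A)

/-- The supremum over the available actions of the integral of `u` against the kernel. -/
def supInt (u : X → ℝ≥0∞) (x : X) : ℝ≥0∞ := ⨆ a ∈ M.act x, ∫⁻ y, u y ∂(M.q (x, a))

variable {M}

lemma lintegral_le_supInt (u : X → ℝ≥0∞) {x : X} {a : A} (ha : a ∈ M.act x) :
    ∫⁻ y, u y ∂(M.q (x, a)) ≤ M.supInt u x :=
  le_iSup₂ (f := fun a (_ : a ∈ M.act x) => ∫⁻ y, u y ∂(M.q (x, a))) a ha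

lemma supInt_mono : Monotone M.supInt := fun _ _ h _ =>
  iSup₂_mono fun _ _ => lintegral_mono h

lemma supInt_add_le {u : X → ℝ≥0∞} (hu : Measurable u) (w : X → ℝ≥0∞) (x : X) :
    M.supInt (u + w) x ≤ M.supInt u x + M.supInt w x :=
  iSup₂_le fun _ ha => (lintegral_add_left hu w).trans_le
    (add_le_add (lintegral_le_supInt u ha) (lintegral_le_supInt w ha))

lemma supInt_const_mul {u : X → ℝ≥0∞} (hu : Measurable u) (r : ℝ≥0∞) (x : X) :
    M.supInt (fun y => r * u y) x = r * M.supInt u x := by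
  simp only [supInt, ENNReal.mul_iSup]
  exact iSup_congr fun _ => iSup_congr fun _ => lintegral_const_mul r hu

lemma supInt_iSup {u : ℕ → X → ℝ≥0∞} (hu : ∀ n, Measurable (u n)) (hmono : Monotone u) (x : X) :
    M.supInt (fun y => ⨆ n, u n y) x = ⨆ n, M.supInt (u n) x := by
  simp only [supInt]
  rw [iSup_comm]
  refine iSup_congr fun a => ?_
  rw [iSup_comm]
  refine iSup_congr fun ha => ?_
  exact lintegral_iSup hu hmono

lemma Stationary.iterate_Q_mono (φ : M.Stationary) (n : ℕ) : Monotone φ.Q^[n] :=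
  Monotone.iterate (f := φ.Q) (fun _ _ h => φ.Q_mono h) n

lemma Stationary.iterate_Q_const_mul (φ : M.Stationary) {u : X → ℝ≥0∞} (hu : Measurable u)
    (r : ℝ≥0∞) (n : ℕ) : φ.Q^[n] (fun y => r * u y) = fun x => r * φ.Q^[n] u x := by
  induction n with
  | zero => rfl
  | succ n ih =>
    rw [Function.iterate_succ_apply', ih, φ.Q_const_mul (φ.measurable_iterate_Q hu n),
      Function.iterate_succ_apply']

lemma Stationary.iterate_Q_add (φ : M.Stationary) {u w : X → ℝ≥0∞} (hu : Measurable u) (n : ℕ) :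
    φ.Q^[n] (u + w) = φ.Q^[n] u + φ.Q^[n] w := by
  induction n with
  | zero => rfl
  | succ n ih =>
    simp only [Function.iterate_succ_apply', ih, φ.Q_add (φ.measurable_iterate_Q hu n)]

/-- If `U ≤ V + Q_φ U` and `U ≤ C V`, then `U` is bounded by the total `∑ₙ Q_φⁿ V`, provided that it
is finite. -/
lemma Stationary.le_tsum_iterate (φ : M.Stationary) {U V : X → ℝ≥0∞} (hV : Measurable V)
    {C : ℝ≥0} (hUV : ∀ x, U x ≤ C * V x) (hU : ∀ x, U x ≤ V x + φ.Q U x) {x : X}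
    (hfin : ∑' n, φ.Q^[n] V x ≠ ⊤) : U x ≤ ∑' n, φ.Q^[n] V x := by
  have key : ∀ N, U x ≤ ∑ n ∈ Finset.range N, φ.Q^[n] V x + φ.Q^[N] U x := by
    intro N
    induction N with
    | zero => simp
    | succ N ih =>
      refine ih.trans ?_
      rw [Finset.sum_range_succ, add_assoc (Finset.sum (Finset.range N) _)]
      gcongr
      calc φ.Q^[N] U x ≤ φ.Q^[N] (V + φ.Q U) x := φ.iterate_Q_mono N hU x
        _ = φ.Q^[N] V x + φ.Q^[N + 1] U x := by
          rw [φ.iterate_Q_add hV, Function.iterate_succ_apply]; rfl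
  have hlim : Tendsto (fun N => ∑' n, φ.Q^[n] V x + C * φ.Q^[N] V x) atTop
      (𝓝 (∑' n, φ.Q^[n] V x)) := by
    have h0 := ENNReal.Tendsto.const_mul (a := (C : ℝ≥0∞))
      (ENNReal.tendsto_atTop_zero_of_tsum_ne_top hfin) (Or.inr ENNReal.coe_ne_top)
    simpa using h0.const_add (∑' n, φ.Q^[n] V x)
  refine ge_of_tendsto' hlim fun N => (key N).trans ?_
  gcongr ?_ + ?_
  · exact ENNReal.sum_le_tsum _
  · exact (φ.iterate_Q_mono N hUV x).trans (congrFun (φ.iterate_Q_const_mul hV C N) x).le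

end MaxOperator

section Weight

variable {X A : Type*} [MetricSpace X] [MeasurableSpace X] [MeasurableSpace A] {M : MDP X A}
  {V : X → ℝ≥0} {K : ℝ≥0}

lemma AssumptionT.one_le_const (hT : M.AssumptionT V K) (x : X) : 1 ≤ K := by
  obtain ⟨f, hf, hfa⟩ := M.exists_selector
  have h : (V x : ℝ≥0∞) ≤ K * V x :=
    (ENNReal.le_tsum (f := fun n => (Stationary.Q ⟨f, hf, hfa⟩)^[n] (fun y => (V y : ℝ≥0∞)) x)
      0).trans (hT.bound ⟨f, hf, hfa⟩ x)
  have h' : 1 * V x ≤ K * V x := by rw [one_mul]; exact_mod_cast h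
  exact le_of_mul_le_mul_right h' (one_pos.trans_le (hT.one_le x))

variable [BorelSpace X]

/-- Every feasible action is taken by some stationary policy, which differs from a fixed one at a
single state. -/
lemma AssumptionT.lintegral_le (hT : M.AssumptionT V K) {x : X} {a : A} (ha : a ∈ M.act x) :
    ∫⁻ y, V y ∂(M.q (x, a)) ≤ K * V x := by
  classical
  obtain ⟨f, hf, hfa⟩ := M.exists_selector
  let φ : M.Stationary :=
    { toFun := fun y => if y = x then a else f y
      measurable := Measurable.ite (measurableSet_singleton x) measurable_const hf
      feasible := fun y => by
        by_cases h : y = x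
        · simpa [h] using ha
        · simpa [h] using hfa y }
  have h1 : φ.Q^[1] (fun y => (V y : ℝ≥0∞)) x = ∫⁻ y, V y ∂(M.q (x, a)) := by
    simp [Stationary.Q, φ]
  rw [← h1]
  exact (ENNReal.le_tsum (f := fun n => φ.Q^[n] (fun y => (V y : ℝ≥0∞)) x) 1).trans (hT.bound φ x)

lemma AssumptionT.supInt_le (hT : M.AssumptionT V K) (x : X) :
    M.supInt (fun y => (V y : ℝ≥0∞)) x ≤ K * V x :=
  iSup₂_le fun _ ha => hT.lintegral_le ha

lemma AssumptionT.supInt_le_of_le (hT : M.AssumptionT V K) {u : X → ℝ≥0∞} {C : ℝ≥0}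
    (hu : ∀ x, u x ≤ C * V x) (x : X) : M.supInt u x ≤ (C * K : ℝ≥0) * V x := by
  refine (supInt_mono hu x).trans ?_
  rw [supInt_const_mul hT.continuous.measurable.coe_nnreal_ennreal, ENNReal.coe_mul, mul_assoc]
  gcongr
  exact hT.supInt_le x

variable [MetricSpace A]

lemma AssumptionWC.continuousOn_lintegral (hWC : M.AssumptionWC) (hT : M.AssumptionT V K)
    (hV : ContinuousOn (fun z => ∫⁻ y, (V y : ℝ≥0∞) ∂(M.q z)) M.graph)
    {u : X → ℝ≥0∞} (hu : Continuous u) {C : ℝ≥0} (huC : ∀ x, u x ≤ C * V x) :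
    ContinuousOn (fun z => ∫⁻ y, u y ∂(M.q z)) M.graph := by
  have hC : ∀ z, ∫⁻ y, ((C * V y : ℝ≥0) : ℝ≥0∞) ∂(M.q z) = C * ∫⁻ y, V y ∂(M.q z) := by
    intro z
    simp_rw [ENNReal.coe_mul]
    exact lintegral_const_mul _ hT.continuous.measurable.coe_nnreal_ennreal
  refine continuousOn_lintegral_of_le_weight hWC.weak_continuous (w := fun y => C * V y)
    (continuous_const.mul hT.continuous) ?_ ?_ hu (fun x => by
      rw [ENNReal.coe_mul]; exact huC x)
  · simp_rw [hC]
    exact (ENNReal.continuous_const_mul ENNReal.coe_ne_top).comp_continuousOn hV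
  · rintro ⟨x, a⟩ hz
    rw [hC]
    exact ENNReal.mul_ne_top ENNReal.coe_ne_top
      (ne_top_of_le_ne_top (ENNReal.mul_ne_top ENNReal.coe_ne_top ENNReal.coe_ne_top)
        (hT.lintegral_le hz))

lemma AssumptionWC.continuous_supInt (hWC : M.AssumptionWC) (hT : M.AssumptionT V K)
    (hV : ContinuousOn (fun z => ∫⁻ y, (V y : ℝ≥0∞) ∂(M.q z)) M.graph)
    {u : X → ℝ≥0∞} (hu : Continuous u) {C : ℝ≥0} (huC : ∀ x, u x ≤ C * V x) :
    Continuous (M.supInt u) :=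
  continuous_biSup hWC.isCompact_act hWC.isOpen_subset hWC.isOpen_inter
    (hWC.continuousOn_lintegral hT hV hu huC)

variable [SecondCountableTopology A] [BorelSpace A]

lemma AssumptionWC.exists_stationary_supInt (hWC : M.AssumptionWC) (hT : M.AssumptionT V K)
    (hV : ContinuousOn (fun z => ∫⁻ y, (V y : ℝ≥0∞) ∂(M.q z)) M.graph)
    {u : X → ℝ≥0∞} (hu : Continuous u) {C : ℝ≥0} (huC : ∀ x, u x ≤ C * V x) :
    ∃ φ : M.Stationary, ∀ x, φ.Q u x = M.supInt u x := by
  -- Inversion is an order-reversing homeomorphism of `[0, ∞]`: maximizers are minimizers of it.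
  obtain ⟨φ, hφ, h⟩ := exists_measurable_argmin M.act_nonempty hWC.isCompact_act
    hWC.isOpen_subset (f := fun z => (∫⁻ y, u y ∂(M.q z))⁻¹)
    (continuous_inv.comp_continuousOn
      (hWC.continuousOn_lintegral hT hV hu huC)).lowerSemicontinuousOn
  refine ⟨⟨φ, hφ, fun x => (h x).1⟩, fun x => ?_⟩
  have hx := (h x).2
  simp_rw [← ENNReal.inv_iSup] at hx
  exact inv_injective hx

variable (M V) in
/-- `IsTotalWeight M V K δ U`: the function `U` is continuous, lies between `V` and `K V`, and
solves the optimality equation for the maximal total reward with one-step reward `V` and kernel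
`δ q`. -/
structure IsTotalWeight (K δ : ℝ≥0) (U : X → ℝ≥0∞) : Prop where
  continuous : Continuous U
  le_weight : ∀ x, V x ≤ U x
  weight_le : ∀ x, U x ≤ K * V x
  eq_add : ∀ x, U x = V x + δ * M.supInt U x

/-- If the kernel `δ q` contracts some continuous weight `w` comparable with `V`, then the iterates
`Uₙ₊₁ = V + δ sup ∫ Uₙ dq` converge geometrically relative to `w`; so their limit is continuous. It
is bounded by `K V` because the maximizing actions form a stationary policy. -/
lemma AssumptionT.exists_isTotalWeight (hT : M.AssumptionT V K) (hWC : M.AssumptionWC)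
    (hV : ContinuousOn (fun z => ∫⁻ y, (V y : ℝ≥0∞) ∂(M.q z)) M.graph)
    {δ ρ C : ℝ≥0} (hδ : δ ≤ 1) (hρ : ρ < 1) {w : X → ℝ≥0∞} (hw : Continuous w)
    (hVw : ∀ x, V x ≤ w x) (hwC : ∀ x, w x ≤ C * V x)
    (hcontr : ∀ x, δ * M.supInt w x ≤ ρ * w x) : ∃ U, IsTotalWeight M V K δ U := by
  let T : (X → ℝ≥0∞) → X → ℝ≥0∞ := fun u x => V x + δ * M.supInt u x
  let U : ℕ → X → ℝ≥0∞ := fun n => T^[n] 0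
  have hUs : ∀ n x, U (n + 1) x = V x + δ * M.supInt (U n) x := fun n x =>
    congrFun (Function.iterate_succ_apply' T n 0) x
  have hTm : Monotone T := fun u u' h x => by
    simp only [T]
    gcongr
    exact supInt_mono h x
  have hmono : Monotone U := hTm.monotone_iterate_of_le_map (fun _ => zero_le)
  have hVc : Continuous fun x => (V x : ℝ≥0∞) := ENNReal.continuous_coe.comp hT.continuous
  have hreg : ∀ n, Continuous (U n) ∧ ∃ D : ℝ≥0, ∀ x, U n x ≤ D * V x := by
    intro n
    induction n with
    | zero => exact ⟨continuous_const, 0, fun x => zero_le⟩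
    | succ n ih =>
      obtain ⟨hc, D, hD⟩ := ih
      rw [show U (n + 1) = fun x => V x + δ * M.supInt (U n) x from funext (hUs n)]
      refine ⟨hVc.add ((ENNReal.continuous_const_mul ENNReal.coe_ne_top).comp
        (hWC.continuous_supInt hT hV hc hD)), 1 + δ * (D * K), fun x => ?_⟩
      change V x + δ * M.supInt (U n) x ≤ _
      rw [ENNReal.coe_add, add_mul, ENNReal.coe_one, one_mul, ENNReal.coe_mul, mul_assoc]
      gcongr
      exact hT.supInt_le_of_le hD x
  have hcont : ∀ n, Continuous (U n) := fun n => (hreg n).1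
  -- Contraction: consecutive iterates differ by at most a geometric multiple of `w`.
  have hstep : ∀ n x, U (n + 1) x ≤ U n x + ρ ^ n * w x := by
    intro n
    induction n with
    | zero =>
      intro x
      rw [hUs]
      have h0 : M.supInt (U 0) x = 0 := by simp [U, supInt]
      rw [h0]
      simpa [U] using hVw x
    | succ n ih =>
      intro x
      rw [hUs (n + 1), hUs n, add_assoc]
      gcongr
      calc δ * M.supInt (U (n + 1)) x
          ≤ δ * (M.supInt (U n) x + M.supInt (fun y => ρ ^ n * w y) x) := by
            gcongr
            exact (supInt_mono ih x).trans (supInt_add_le (hcont n).measurable _ x)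
        _ = δ * M.supInt (U n) x + ρ ^ n * (δ * M.supInt w x) := by
            rw [supInt_const_mul hw.measurable]; ring
        _ ≤ δ * M.supInt (U n) x + ρ ^ n * (ρ * w x) := by gcongr _ + _ * ?_; exact hcontr x
        _ = δ * M.supInt (U n) x + ρ ^ (n + 1) * w x := by ring
  have hρ' : (ρ : ℝ≥0∞) < 1 := by exact_mod_cast hρ
  let r : ℕ → ℝ≥0∞ := fun n => (ρ : ℝ≥0∞) ^ n * (1 - (ρ : ℝ≥0∞))⁻¹
  have hrfin : (1 - (ρ : ℝ≥0∞))⁻¹ ≠ ⊤ := ENNReal.inv_ne_top.2 (tsub_pos_of_lt hρ').ne'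
  have hr : ∀ n, r n ≠ ⊤ := fun n =>
    ENNReal.mul_ne_top (ENNReal.pow_ne_top ENNReal.coe_ne_top) hrfin
  have htail : ∀ n k x, U (n + k) x ≤ U n x + (∑ i ∈ Finset.range k, (ρ : ℝ≥0∞) ^ (n + i)) * w x := by
    intro n k x
    induction k with
    | zero => simp
    | succ k ih =>
      rw [Finset.sum_range_succ, add_mul, ← add_assoc (U n x)]
      exact (hstep (n + k) x).trans (add_le_add ih le_rfl)
  have hsum : ∀ n k, ∑ i ∈ Finset.range k, (ρ : ℝ≥0∞) ^ (n + i) ≤ r n := by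
    intro n k
    simp only [pow_add, ← Finset.mul_sum, r]
    gcongr
    rw [← ENNReal.tsum_geometric]
    exact ENNReal.sum_le_tsum _
  let W : X → ℝ≥0∞ := fun x => ⨆ n, U n x
  have hWle : ∀ n x, W x ≤ U n x + r n * w x := by
    intro n x
    refine iSup_le fun m => ?_
    refine (hmono (Nat.le_add_left m n) x).trans ((htail n m x).trans ?_)
    gcongr
    exact hsum n m
  have hwfin : ∀ x, w x ≠ ⊤ := fun x =>
    ne_top_of_le_ne_top (ENNReal.mul_ne_top ENNReal.coe_ne_top ENNReal.coe_ne_top) (hwC x)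
  have hr0 : Tendsto r atTop (𝓝 0) := by
    have := ENNReal.Tendsto.mul_const (ENNReal.tendsto_pow_atTop_nhds_zero_of_lt_one hρ')
      (Or.inr hrfin)
    simpa only [zero_mul] using this
  have hinf : W = fun x => ⨅ n, (U n x + r n * w x) := by
    funext x
    refine le_antisymm (le_iInf fun n => hWle n x) ?_
    have hlim : Tendsto (fun n => W x + r n * w x) atTop (𝓝 (W x)) := by
      have := (ENNReal.Tendsto.mul_const hr0 (Or.inr (hwfin x))).const_add (W x)
      simpa using this
    refine ge_of_tendsto' hlim fun n => (iInf_le _ n).trans ?_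
    gcongr
    exact le_iSup (fun n => U n x) n
  -- The limit is a supremum and, by the geometric error bounds, also an infimum of continuous
  -- functions.
  have hWc : Continuous W := by
    rw [continuous_iff_lower_upperSemicontinuous]
    refine ⟨lowerSemicontinuous_iSup fun n => (hcont n).lowerSemicontinuous, ?_⟩
    rw [hinf]
    exact upperSemicontinuous_iInf fun n => ((hcont n).add
      ((ENNReal.continuous_const_mul (hr n)).comp hw)).upperSemicontinuous
  have hWeq : ∀ x, W x = V x + δ * M.supInt W x := by
    intro x
    have h1 : W x = ⨆ n, U (n + 1) x := 
      (Monotone.iSup_nat_add (f := fun n => U n x) (fun i j h => hmono h x) 1).symm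
    rw [h1, supInt_iSup (fun n => (hcont n).measurable) hmono, ENNReal.mul_iSup, ENNReal.add_iSup]
    exact iSup_congr fun n => hUs n x
  have hWD : ∃ D : ℝ≥0, ∀ x, W x ≤ D * V x := by
    refine ⟨(r 0).toNNReal * C, fun x => ?_⟩
    rw [ENNReal.coe_mul, ENNReal.coe_toNNReal (hr 0), mul_assoc]
    refine (hWle 0 x).trans ?_
    simp only [U, Function.iterate_zero, id, Pi.zero_apply, zero_add]
    gcongr
    exact hwC x
  obtain ⟨D, hD⟩ := hWD
  obtain ⟨φ, hφ⟩ := hWC.exists_stationary_supInt hT hV hWc hD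
  refine ⟨W, hWc, fun x => (hWeq x).symm ▸ le_self_add, fun x => ?_, hWeq⟩
  have hfin : ∑' n, φ.Q^[n] (fun y => (V y : ℝ≥0∞)) x ≠ ⊤ :=
    ne_top_of_le_ne_top (ENNReal.mul_ne_top ENNReal.coe_ne_top ENNReal.coe_ne_top) (hT.bound φ x)
  refine (φ.le_tsum_iterate hVc.measurable hD (fun y => ?_) hfin).trans (hT.bound φ x)
  rw [hφ]
  refine (hWeq y).le.trans ?_
  gcongr
  exact mul_le_of_le_one_left zero_le (by exact_mod_cast hδ)

/-- The bound by `K V` makes the kernel `δ q` a contraction with factor `1 - 1 / K` relative to `U`,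
which leaves room to increase `δ` by the factor `1 + 1 / K`. -/
lemma IsTotalWeight.exists_of_le {δ δ' : ℝ≥0} {U : X → ℝ≥0∞} (hU : IsTotalWeight M V K δ U)
    (hT : M.AssumptionT V K) (hWC : M.AssumptionWC)
    (hV : ContinuousOn (fun z => ∫⁻ y, (V y : ℝ≥0∞) ∂(M.q z)) M.graph) (hK : 1 ≤ K)
    (hδ' : δ' ≤ 1) (hδδ : δ' ≤ (1 + K⁻¹) * δ) : ∃ U', IsTotalWeight M V K δ' U' := by
  have hKpos : (0 : ℝ) < K := by exact_mod_cast one_pos.trans_le hK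
  have hK1 : (1 : ℝ) ≤ K := by exact_mod_cast hK
  have hk0 : (0 : ℝ) < (K : ℝ)⁻¹ := inv_pos.2 hKpos
  have hk1 : (K : ℝ)⁻¹ ≤ 1 := inv_le_one_of_one_le₀ hK1
  let ρ : ℝ≥0 := ⟨(1 + (K : ℝ)⁻¹) * (1 - (K : ℝ)⁻¹), mul_nonneg (by positivity) (by linarith)⟩
  have hρ : ρ < 1 := by
    rw [← NNReal.coe_lt_coe]
    change (1 + (K : ℝ)⁻¹) * (1 - (K : ℝ)⁻¹) < 1
    nlinarith
  refine hT.exists_isTotalWeight hWC hV hδ' hρ hU.continuous hU.le_weight hU.weight_le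
    fun x => ?_
  have hUfin : U x ≠ ⊤ :=
    ne_top_of_le_ne_top (ENNReal.mul_ne_top ENNReal.coe_ne_top ENNReal.coe_ne_top) (hU.weight_le x)
  have hSfin : M.supInt U x ≠ ⊤ :=
    ne_top_of_le_ne_top (ENNReal.mul_ne_top ENNReal.coe_ne_top ENNReal.coe_ne_top)
      (hT.supInt_le_of_le hU.weight_le x)
  have h1 := hU.eq_add x
  have h2 := hU.weight_le x
  lift U x to ℝ≥0 using hUfin with a
  lift M.supInt U x to ℝ≥0 using hSfin with s
  have h1' : (a : ℝ) = V x + δ * s := by exact_mod_cast h1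
  have h2' : (a : ℝ) ≤ K * V x := by exact_mod_cast h2
  have hδδ' : (δ' : ℝ) ≤ (1 + (K : ℝ)⁻¹) * δ := by exact_mod_cast hδδ
  have h3 : (K : ℝ)⁻¹ * a ≤ V x := by rwa [inv_mul_le_iff₀ hKpos]
  have h4 : (δ' : ℝ) * s ≤ (1 + (K : ℝ)⁻¹) * (1 - (K : ℝ)⁻¹) * a := by
    calc (δ' : ℝ) * s ≤ (1 + (K : ℝ)⁻¹) * δ * s := by gcongr
      _ = (1 + (K : ℝ)⁻¹) * (a - V x) := by rw [h1']; ring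
      _ ≤ (1 + (K : ℝ)⁻¹) * (a - (K : ℝ)⁻¹ * a) := by gcongr
      _ = (1 + (K : ℝ)⁻¹) * (1 - (K : ℝ)⁻¹) * a := by ring
  have h5 : δ' * s ≤ ρ * a := by
    rw [← NNReal.coe_le_coe]
    exact h4
  exact_mod_cast h5

/-- A continuous weight for the HV transformation: the maximal total reward for the one-step reward
`V`. It is reached from the kernel `q / (2 K)`, which contracts `V`, by increasing the factor of `q`
to one in finitely many steps. -/
lemma AssumptionT.exists_isHVWeight (hT : M.AssumptionT V K) (hWC : M.AssumptionWC)
    (hV : ContinuousOn (fun z => ∫⁻ y, (V y : ℝ≥0∞) ∂(M.q z)) M.graph) :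
    ∃ μ : X → ℝ≥0, M.IsHVWeight V K μ := by
  rcases isEmpty_or_nonempty X with hX | ⟨⟨x₀⟩⟩
  · exact ⟨V, hT.continuous, hT.one_le, isEmptyElim, isEmptyElim, isEmptyElim⟩
  have hK : 1 ≤ K := hT.one_le_const x₀
  have hKpos : 0 < K := one_pos.trans_le hK
  have hVc : Continuous fun x => (V x : ℝ≥0∞) := ENNReal.continuous_coe.comp hT.continuous
  let δ : ℕ → ℝ≥0 := fun n => min 1 ((1 + K⁻¹) ^ n * (2 * K)⁻¹)
  have hδ : ∀ n, ∃ U, IsTotalWeight M V K (δ n) U := by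
    intro n
    induction n with
    | zero =>
      refine hT.exists_isTotalWeight hWC hV (min_le_left _ _) (ρ := 2⁻¹) (C := 1)
        two_inv_lt_one hVc (fun x => le_rfl) (fun x => by simp) fun x => ?_
      have h1 : δ 0 * (K * V x) ≤ 2⁻¹ * V x := by
        calc δ 0 * (K * V x) ≤ (2 * K)⁻¹ * (K * V x) := by
              gcongr
              simp [δ]
          _ = 2⁻¹ * V x := by field_simp
      calc (δ 0 : ℝ≥0∞) * M.supInt (fun y => (V y : ℝ≥0∞)) x ≤ δ 0 * (K * V x) := by
            gcongr
            exact hT.supInt_le x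
        _ ≤ (2⁻¹ : ℝ≥0) * V x := by exact_mod_cast h1
    | succ n ih =>
      obtain ⟨U, hU⟩ := ih
      refine hU.exists_of_le hT hWC hV hK (min_le_left _ _) ?_
      simp only [δ]
      rcases le_total 1 ((1 + K⁻¹) ^ n * (2 * K)⁻¹) with h | h
      · rw [min_eq_left h, mul_one]
        exact (min_le_left _ _).trans le_self_add
      · rw [min_eq_right h, pow_succ']
        exact (min_le_right _ _).trans (mul_assoc _ _ _).le
  obtain ⟨n, hn⟩ :=
    pow_unbounded_of_one_lt (2 * K) (lt_add_of_pos_right (1 : ℝ≥0) (inv_pos.2 hKpos))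
  have hδn : δ n = 1 := by
    refine min_eq_left ?_
    rw [← div_eq_mul_inv, one_le_div (by positivity)]
    exact hn.le
  obtain ⟨U, hU⟩ := hδ n
  rw [hδn] at hU
  have hfin : ∀ x, U x ≠ ⊤ := fun x =>
    ne_top_of_le_ne_top (ENNReal.mul_ne_top ENNReal.coe_ne_top ENNReal.coe_ne_top) (hU.weight_le x)
  have hcoe : ∀ x, ((U x).toNNReal : ℝ≥0∞) = U x := fun x => ENNReal.coe_toNNReal (hfin x)
  have hle : ∀ x, V x ≤ (U x).toNNReal := fun x => by
    rw [← ENNReal.coe_le_coe, hcoe]; exact hU.le_weight x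
  refine ⟨fun x => (U x).toNNReal, ENNReal.continuousOn_toNNReal.comp_continuous hU.continuous hfin,
    fun x => (hT.one_le x).trans (hle x), hle, fun x => ?_, fun x a ha => ?_⟩
  · rw [← ENNReal.coe_le_coe, hcoe, ENNReal.coe_mul]
    exact hU.weight_le x
  · simp_rw [hcoe]
    rw [hU.eq_add x, ENNReal.coe_one, one_mul]
    gcongr
    exact lintegral_le_supInt U ha

end Weight

/-! ### The HV transformation -/

section HVTransformation

variable {X A : Type*}

/-- The function on the HV-transformed state space that corresponds to `w`: it is `μ⁻¹ w` on the old
states and vanishes at the new one. -/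
def hvLift (μ : X → ℝ≥0) (w : X → ℝ≥0∞) : X ⊕ Unit → ℝ≥0∞ :=
  Sum.elim (fun x => (μ x : ℝ≥0∞)⁻¹ * w x) 0

lemma measurable_hvLift [MeasurableSpace X] {μ : X → ℝ≥0} (hμ : Measurable μ) {w : X → ℝ≥0∞}
    (hw : Measurable w) :
    Measurable (hvLift μ w) :=
  (hμ.coe_nnreal_ennreal.inv.mul hw).sumElim measurable_const

lemma hvLift_iSup (μ : X → ℝ≥0) (w : ℕ → X → ℝ≥0∞) (s : X ⊕ Unit) :
    hvLift μ (fun x => ⨆ n, w n x) s = ⨆ n, hvLift μ (w n) s := by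
  rcases s with x | u
  · exact ENNReal.mul_iSup _ _
  · simp [hvLift]

variable [MeasurableSpace X] [MeasurableSpace A] [TopologicalSpace X] {M : MDP X A}
  {V : X → ℝ≥0} {K : ℝ≥0} {μ : X → ℝ≥0}

lemma IsHVWeight.coe_ne_zero (hμ : M.IsHVWeight V K μ) (x : X) : (μ x : ℝ≥0∞) ≠ 0 := by
  have := one_pos.trans_le (hμ.one_le x)
  exact_mod_cast this.ne'

lemma IsHVWeight.hvLift_injective (hμ : M.IsHVWeight V K μ) {u w : X → ℝ≥0∞}
    (h : hvLift μ u = hvLift μ w) : u = w := by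
  funext x
  have hx : (μ x : ℝ≥0∞)⁻¹ * u x = (μ x : ℝ≥0∞)⁻¹ * w x := congrFun h (Sum.inl x)
  exact (ENNReal.mul_right_inj (ENNReal.inv_ne_zero.2 ENNReal.coe_ne_top)
    (ENNReal.inv_ne_top.2 (hμ.coe_ne_zero x))).1 hx

variable [BorelSpace X] (hμ : M.IsHVWeight V K μ) {β : ℝ≥0} (hβ : 0 < β)
  (hKβ : ((K : ℝ) - 1) / K ≤ β)

lemma hv_mass (z : (X ⊕ Unit) × (A ⊕ Unit)) : (hv hμ hβ hKβ).mass z = β := by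
  change ((β : ℝ≥0∞) • M.hvProb μ β z) univ = β
  rw [Measure.smul_apply, hμ.hvProb_univ hβ hKβ, smul_eq_mul, mul_one]

/-- Integration in the HV-transformed model is integration in the original model, after division
by `μ`. -/
lemma lintegral_hvLift {x : X} {a : A} (ha : a ∈ M.act x) {w : X → ℝ≥0∞} (hw : Measurable w) :
    ∫⁻ s, hvLift μ w s ∂((hv hμ hβ hKβ).q (Sum.inl x, Sum.inl a)) =
      (μ x : ℝ≥0∞)⁻¹ * ∫⁻ y, w y ∂(M.q (x, a)) := by
  have hμm := hμ.continuous.measurable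
  have hq : (hv hμ hβ hKβ).q (Sum.inl x, Sum.inl a) =
      (β : ℝ≥0∞) • ((M.hvSub μ β (x, a)).map Sum.inl
        + (1 - M.hvSub μ β (x, a) univ) • Measure.dirac (Sum.inr ())) := by
    change (β : ℝ≥0∞) • M.hvProb μ β (Sum.inl x, Sum.inl a) = _
    simp only [hvProb, if_pos ha]
  have hsub : ∫⁻ y, hvLift μ w (Sum.inl y) ∂(M.hvSub μ β (x, a)) =
      ((β * μ x : ℝ≥0) : ℝ≥0∞)⁻¹ * ∫⁻ y, w y ∂(M.q (x, a)) := by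
    have hm : Measurable fun y => hvLift μ w (Sum.inl y) :=
      (measurable_hvLift hμm hw).comp measurable_inl
    rw [hvSub, lintegral_smul_measure, smul_eq_mul, lintegral_withDensity_eq_lintegral_mul _
      hμm.coe_nnreal_ennreal hm]
    congr 1
    refine lintegral_congr fun y => ?_
    exact ENNReal.mul_inv_cancel_left (hμ.coe_ne_zero y) ENNReal.coe_ne_top
  have hβ0 : (β : ℝ≥0∞) ≠ 0 := by exact_mod_cast hβ.ne'
  rw [hq, lintegral_smul_measure, lintegral_add_measure, lintegral_smul_measure,
    lintegral_dirac' _ (measurable_hvLift hμm hw),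
    lintegral_map (measurable_hvLift hμm hw) measurable_inl, hsub, ENNReal.coe_mul,
    ENNReal.mul_inv (Or.inl hβ0) (Or.inl ENNReal.coe_ne_top)]
  simp only [hvLift, Sum.elim_inr, Pi.zero_apply, mul_zero, add_zero, smul_eq_mul]
  rw [mul_assoc, ENNReal.mul_inv_cancel_left hβ0 ENNReal.coe_ne_top]

lemma lintegral_hvLift_inr (s : (X ⊕ Unit) × (A ⊕ Unit)) (hs : s = (Sum.inr (), Sum.inr ()))
    {w : X → ℝ≥0∞} (hw : Measurable w) :
    ∫⁻ t, hvLift μ w t ∂((hv hμ hβ hKβ).q s) = 0 := by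
  subst hs
  change ∫⁻ t, hvLift μ w t ∂((β : ℝ≥0∞) • Measure.dirac (Sum.inr ())) = 0
  rw [lintegral_smul_measure, lintegral_dirac' _ (measurable_hvLift hμ.continuous.measurable hw)]
  simp [hvLift]

lemma hv_c {x : X} {a : A} (ha : a ∈ M.act x) :
    ((hv hμ hβ hKβ).c (Sum.inl x, Sum.inl a) : ℝ≥0∞) = (μ x : ℝ≥0∞)⁻¹ * M.c (x, a) := by
  have : (hv hμ hβ hKβ).c (Sum.inl x, Sum.inl a) = (μ x)⁻¹ * M.c (x, a) := by
    change M.hvCost μ (Sum.inl x, Sum.inl a) = _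
    simp only [hvCost, if_pos ha]
  rw [this, ENNReal.coe_mul, ENNReal.coe_inv]
  exact_mod_cast hμ.coe_ne_zero x

lemma bellman_hvLift {w : X → ℝ≥0∞} (hw : Measurable w) :
    (hv hμ hβ hKβ).bellman (hvLift μ w) = hvLift μ (M.bellman w) := by
  funext s
  rcases s with x | u
  · have h1 : (hv hμ hβ hKβ).bellman (hvLift μ w) (Sum.inl x) =
        ⨅ a ∈ M.act x, ((hv hμ hβ hKβ).c (Sum.inl x, Sum.inl a) : ℝ≥0∞) +
          ∫⁻ s, hvLift μ w s ∂((hv hμ hβ hKβ).q (Sum.inl x, Sum.inl a)) := iInf_image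
    have h2 : hvLift μ (M.bellman w) (Sum.inl x) = (μ x : ℝ≥0∞)⁻¹ * M.bellman w x := rfl
    have h0 : (μ x : ℝ≥0∞)⁻¹ ≠ 0 := ENNReal.inv_ne_zero.2 ENNReal.coe_ne_top
    have ht : (μ x : ℝ≥0∞)⁻¹ ≠ ⊤ := ENNReal.inv_ne_top.2 (hμ.coe_ne_zero x)
    rw [h1, h2, bellman, ENNReal.mul_iInf_of_ne h0 ht]
    refine iInf_congr fun a => ?_
    rw [ENNReal.mul_iInf_of_ne h0 ht]
    refine iInf_congr fun ha => ?_
    rw [hv_c hμ hβ hKβ ha, lintegral_hvLift hμ hβ hKβ ha hw, mul_add]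
  · refine le_antisymm ((bellman_le (a := Sum.inr ()) (mem_singleton _)).trans ?_) zero_le
    rw [lintegral_hvLift_inr hμ hβ hKβ _ rfl hw]
    change ((M.hvCost μ (Sum.inr (), Sum.inr ()) : ℝ≥0) : ℝ≥0∞) + 0 ≤ 0
    simp [hvCost]

lemma Stationary.hv_c (φ : M.Stationary) : (φ.hv hμ hβ hKβ).c = hvLift μ φ.c := by
  funext s
  rcases s with x | u
  · exact MDP.hv_c hμ hβ hKβ (φ.feasible x)
  · change ((M.hvCost μ (Sum.inr (), Sum.inr ()) : ℝ≥0) : ℝ≥0∞) = 0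
    simp [hvCost]

lemma Stationary.hv_Q (φ : M.Stationary) {w : X → ℝ≥0∞} (hw : Measurable w) :
    (φ.hv hμ hβ hKβ).Q (hvLift μ w) = hvLift μ (φ.Q w) := by
  funext s
  rcases s with x | u
  · exact lintegral_hvLift hμ hβ hKβ (φ.feasible x) hw
  · exact lintegral_hvLift_inr hμ hβ hKβ _ rfl hw

lemma Stationary.hv_cost (φ : M.Stationary) :
    (φ.hv hμ hβ hKβ).toPolicy.cost = hvLift μ φ.toPolicy.cost := by
  have hiter : ∀ n, (φ.hv hμ hβ hKβ).Q^[n] (φ.hv hμ hβ hKβ).c = hvLift μ (φ.Q^[n] φ.c) := by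
    intro n
    induction n with
    | zero => exact φ.hv_c hμ hβ hKβ
    | succ n ih =>
      rw [Function.iterate_succ_apply', ih, Function.iterate_succ_apply',
        φ.hv_Q hμ hβ hKβ (φ.measurable_iterate_Q φ.measurable_c n)]
  funext s
  rw [Stationary.cost_eq]
  simp_rw [hiter]
  rcases s with x | u
  · change ∑' n, (μ x : ℝ≥0∞)⁻¹ * φ.Q^[n] φ.c x = (μ x : ℝ≥0∞)⁻¹ * φ.toPolicy.cost x
    rw [ENNReal.tsum_mul_left, φ.cost_eq]
  · simp [hvLift]

lemma hv_valueIter (hm : ∀ n, Measurable (M.valueIter n)) (n : ℕ) :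
    (hv hμ hβ hKβ).valueIter n = hvLift μ (M.valueIter n) := by
  induction n with
  | zero =>
    funext s
    rcases s with x | u
    · exact (mul_zero _).symm
    · rfl
  | succ n ih => rw [valueIter_succ, valueIter_succ, ih, bellman_hvLift hμ hβ hKβ (hm n)]

end HVTransformation

section HVValue

variable {X A : Type*} [MetricSpace X] [MeasurableSpace X] [BorelSpace X]
  [MetricSpace A] [SecondCountableTopology A] [MeasurableSpace A] [BorelSpace A] {M : MDP X A}
  {V : X → ℝ≥0} {K : ℝ≥0} {μ : X → ℝ≥0} (hμ : M.IsHVWeight V K μ) {β : ℝ≥0} (hβ : 0 < β)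
  (hKβ : ((K : ℝ) - 1) / K ≤ β)

/-- The value function of the HV-transformed model is `μ⁻¹ v`. The upper bound comes from an optimal
stationary policy, the lower one from value iteration. -/
lemma AssumptionWC.hv_value (hWC : M.AssumptionWC) :
    (hv hμ hβ hKβ).value = hvLift μ M.value := by
  have hm := hWC.measurable_valueIter
  funext s
  refine le_antisymm ?_ ?_
  · obtain ⟨φ, hφ⟩ := hWC.exists_optimal
    refine (value_le (φ.hv hμ hβ hKβ).toPolicy s).trans ?_
    rw [φ.hv_cost, show φ.toPolicy.cost = M.value from funext hφ]
  · rw [hWC.value_eq, hvLift_iSup]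
    refine le_trans (iSup_mono fun n => ?_) (iSup_valueIter_le_value (fun n => ?_) s)
    · rw [hv_valueIter hμ hβ hKβ hm]
    · rw [hv_valueIter hμ hβ hKβ hm]
      exact measurable_hvLift hμ.continuous.measurable (hm n)

lemma AssumptionWC.hv_isBetaOptimal_iff (hWC : M.AssumptionWC) (φ : M.Stationary) :
    (φ.hv hμ hβ hKβ).toPolicy.IsBetaOptimal β ↔ φ.toPolicy.IsOptimal := by
  have h : (φ.hv hμ hβ hKβ).toPolicy.IsOptimal ↔ φ.toPolicy.IsOptimal := by
    unfold Policy.IsOptimal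
    rw [← funext_iff, ← funext_iff, φ.hv_cost, hWC.hv_value]
    exact ⟨hμ.hvLift_injective, fun h => h ▸ rfl⟩
  rw [← h]
  exact ⟨fun h => h.2, fun h => ⟨fun z _ => hv_mass hμ hβ hKβ z, h⟩⟩

end HVValue

end MDP

end

theorem mainTheorem2 {X A : Type*}
    [MetricSpace X] [SecondCountableTopology X] [MeasurableSpace X] [BorelSpace X]
    [StandardBorelSpace X]
    [MetricSpace A] [SecondCountableTopology A] [MeasurableSpace A] [BorelSpace A]
    [StandardBorelSpace A]
    (M : MDP X A) (V : X → ℝ≥0) (K : ℝ≥0)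
    (hT : M.AssumptionT V K) (hWC : M.AssumptionWC)
    (hV : ContinuousOn (fun z => ∫⁻ y, (V y : ℝ≥0∞) ∂(M.q z)) M.graph) :
    Measurable M.value ∧
    (∀ x, IsLeast ((fun a => (M.c (x, a) : ℝ≥0∞) + ∫⁻ y, M.value y ∂(M.q (x, a))) '' M.act x)
      (M.value x)) ∧
    (∃ φ : M.Stationary, φ.toPolicy.IsOptimal) ∧
    (∀ φ : M.Stationary,
      φ.toPolicy.IsOptimal ↔ ∀ x, M.value x = φ.c x + φ.Q M.value x) ∧
    (∃ μ : X → ℝ≥0, M.IsHVWeight V K μ) ∧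
    (∀ (μ : X → ℝ≥0) (hμ : M.IsHVWeight V K μ) (β : ℝ≥0) (hβ : 0 < β)
      (hKβ : ((K : ℝ) - 1) / K ≤ β), β < 1 →
      ∀ φ : M.Stationary,
        (∀ x, M.value x = φ.c x + φ.Q M.value x) ↔
          (φ.hv hμ hβ hKβ).toPolicy.IsBetaOptimal β) := by
  refine ⟨hWC.lowerSemicontinuous_value.measurable, hWC.isLeast_value, hWC.exists_optimal,
    fun φ => φ.isOptimal_iff, hT.exists_isHVWeight hWC hV, fun μ hμ β hβ hKβ _ φ => ?_⟩
  rw [hWC.hv_isBetaOptimal_iff hμ hβ hKβ φ, φ.isOptimal_iff]
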